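/- Setting. For $N\in\mathbb N_{\ge1}$, a real $n>0$ and $Q\in\mathbb R_+^N$, let $P_Q$ be the law of independent counts $O_i\sim\mathrm{Pois}(nQ_i)$, $i=1,\dots,N$, and let $U=(1/N,\dots,1/N)$. For a test $\psi:\mathbb N^N\to\{0,1\}$ put $R(\psi;Q)=P_U(\psi=1)+P_Q(\psi=0)$, and for a set $V$ of rate vectors put $R^*(V)=\inf_\psi\sup_{Q\in V}R(\psi;Q)$. For $p\in(0,2]$, $\epsilon>0$ and $\xi$ with $\epsilon\le\xi N^{-1+1/p}$, let $$V_{\epsilon,\xi}=\Big\{Q\in\mathbb R_+^N:\ \sum_{i=1}^N|Q_i-1/N|^p\ge\epsilon^p,\ \max_i|Q_i-1/N|\le\xi/N\Big\}.$$ Let $\lambda=n/N$, $P_\lambda(m)=e^{-\lambda}\lambda^m/m!$, $h_{m,\lambda}(x)=e^{-x}(1+x/\lambda)^m-1$, $g_{m,\lambda}(x)=\tfrac12\big(h_{m,\lambda}(x)+h_{m,\lambda}(-x)\big)$, let $u_{\epsilon,n,N}\ge0$ be given by $$u_{\epsilon,n,N}^2=N\sum_{m=0}^\infty P_\lambda(m)\,g_{m,\lambda}^2\big(n\epsilon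 N^{-1/p}\big),$$ and let $\Phi$ be the standard normal distribution function. (i) Let $n,N\to\infty$ with $n/N\le M$ for a fixed $M$, and $\xi=o(1)$. Then $$2\Phi(-u_{\epsilon,n,N}/2)\le R^*(V_{\epsilon,\xi})+o(1)\qquad\text{and}\qquad R^*(V_{\epsilon,\xi})\le 2\Phi(-u_{\epsilon,n,N}/2)+o(1),$$ uniformly in the other parameters: for all $M$ and $\delta>0$ there are $N_0,n_0,\xi_0>0$ such that both inequalities hold with $\delta$ in place of $o(1)$ whenever $p\in(0,2]$, $N\ge N_0$, $n\ge n_0$, $n/N\le M$, $\xi\le\xi_0$ and $0<\epsilon\le\xi N^{-1+1/p}$. (ii) Let $\Pi_{\epsilon,\xi}$ be the set of product priors $\pi=\prod_{i=1}^N\pi_i$, with $\pi_i$ a probability measure on $[(1-\xi)/N,(1+\xi)/N]$ for every $i$ and $\sum_i\int|t-1/N|^p\,\pi_i(dt)\ge\epsilon^p$. Put $\Delta_m(\pi)=P_\lambda(m)\sum_i\int h_{m,\lambda}(n(t-1/N))\,\pi_i(dt)$, $\mu^0_m=NP_\lambda(m)$ and $\Sigma=\operatorname{diag}(\mu^0)-\mu^0\mu^{0\top}/N$.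 A weight sequence is a non-constant real sequence $w=(w_m)_{m\ge0}$ with $|w_m|\le e^{C(m+1)}$ for some $C>0$ and all $m$. The linear histogram test that rejects when $\big(\sum_m w_mX_m-\langle w,\mu^0\rangle\big)/\sqrt{\langle w,\Sigma w\rangle}>z$, where $X_m=\#\{i:O_i=m\}$, has asymptotic power $\beta(w,z,\pi)=\Phi\big(\langle w,\Delta(\pi)\rangle/\sqrt{\langle w,\Sigma w\rangle}-z\big)$ under $\pi$. Let $\pi^*$ be the product of the symmetric two-point priors $\tfrac12\delta_{1/N+\epsilon N^{-1/p}}+\tfrac12\delta_{1/N-\epsilon N^{-1/p}}$, and let $w^*_m=\Delta_m(\pi^*)/\mu^0_m$. Then, for all $p\in(0,2]$, $N\ge1$, $n>0$, $\xi\le1$ and $0<\epsilon\le\xi N^{-1+1/p}$, we have: $\pi^*\in\Pi_{\epsilon,\xi}$; $w^*$ is a weight sequence; $\langle w^*,\Delta(\pi^*)\rangle/\sqrt{\langle w^*,\Sigma w^*\rangle}=u_{\epsilon,n,N}$; and for every $z\in\mathbb R$, every weight sequence $w$ and every $\pi\in\Pi_{\epsilon,\xi}$, $$\beta(w,z,\pi^*)\le\beta(w^*,z,\pi^*)\le\beta(w^*,z,\pi).$$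 That is, $\pi^*$ is least favorable within $\Pi_{\epsilon,\xi}$ for linear tests of the histogram, and $w^*$ is the optimal weight sequence against it. -/

import Mathlib

open MeasureTheory ProbabilityTheory
open scoped ENNReal

noncomputable section

namespace PoissonUniformity

/-- The standard normal cumulative distribution function `Φ`. -/
def stdNormalCDF (x : ℝ) : ℝ := cdf (gaussianReal 0 1) x

/-- The law of the data under the rate vector `Q`: independent coordinates `O_i ~ Pois(n Q_i)`
(only used for `n > 0` and `Q_i ≥ 0`). -/
def dataLaw (n : ℝ) {N : ℕ} (Q : Fin N → ℝ) : Measure (Fin N → ℕ) :=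
  Measure.pi fun i => poissonMeasure (Real.toNNReal (n * Q i))

/-- The uniform rate vector `U = (1/N, ..., 1/N)`. -/
def unifRate (N : ℕ) : Fin N → ℝ := fun _ => 1 / (N : ℝ)

/-- The risk of the (non-randomized) test `ψ` at the alternative `Q`; `ψ o = true` means that the
null hypothesis is rejected. -/
def testRisk (n : ℝ) {N : ℕ} (ψ : (Fin N → ℕ) → Bool) (Q : Fin N → ℝ) : ℝ :=
  (dataLaw n (unifRate N)).real {o | ψ o = true} + (dataLaw n Q).real {o | ψ o = false}

/-- The minimax risk over a (non-empty) set `V` of rate vectors. All risks lie in `[0, 2]`. -/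
def minimaxRisk (n : ℝ) {N : ℕ} (V : Set (Fin N → ℝ)) : ℝ :=
  ⨅ ψ : (Fin N → ℕ) → Bool, ⨆ Q : V, testRisk n ψ (Q : Fin N → ℝ)

/-- The set of alternatives `V_{ε,ξ}`: non-negative rate vectors outside the `ℓ_p` ball of radius
`ε` around `U` and inside the hypercube of radius `ξ / N` around `U`. -/
def altSet (p : ℝ) (N : ℕ) (ε ξ : ℝ) : Set (Fin N → ℝ) :=
  {Q | (∀ i, 0 ≤ Q i) ∧ ε ^ p ≤ ∑ i, |Q i - 1 / (N : ℝ)| ^ p ∧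
    ∀ i, |Q i - 1 / (N : ℝ)| ≤ ξ / (N : ℝ)}

/-- The Poisson probability mass function `P_lam(m)`. -/
def poisMass (lam : ℝ) (m : ℕ) : ℝ := Real.exp (-lam) * lam ^ m / (m.factorial : ℝ)

/-- `h_{m,lam}(x) = e^{-x} (1 + x / lam)^m - 1`. -/
def hFun (m : ℕ) (lam x : ℝ) : ℝ := Real.exp (-x) * (1 + x / lam) ^ m - 1

/-- `g_{m,lam}`, the symmetrization of `h_{m,lam}`. -/
def gFun (m : ℕ) (lam x : ℝ) : ℝ := (hFun m lam x + hFun m lam (-x)) / 2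

/-- `u_{ε,n,N}`, the non-negative square root of
`N ∑_m P_{n/N}(m) g_{m,n/N}(n ε N^{-1/p})²`. -/
def uVal (p : ℝ) (N : ℕ) (n ε : ℝ) : ℝ :=
  Real.sqrt ((N : ℝ) * ∑' m : ℕ, poisMass (n / N) m *
    gFun m (n / N) (n * ε * (N : ℝ) ^ (-(1 / p))) ^ 2)

/-- The set of priors `Π_{ε,ξ}`; a (product) prior is given by its coordinate laws `π_i`. -/
def priorSet (p : ℝ) (N : ℕ) (ε ξ : ℝ) : Set (Fin N → Measure ℝ) :=
  {π | (∀ i, IsProbabilityMeasure (π i)) ∧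
    ε ^ p ≤ ∑ i, ∫ t, |t - 1 / (N : ℝ)| ^ p ∂(π i) ∧
    ∀ i, π i (Set.Icc ((1 - ξ) / (N : ℝ)) ((1 + ξ) / (N : ℝ))) = 1}

/-- The product of the symmetric two-point priors at `1/N ± ε N^{-1/p}`. -/
def twoPointPrior (p : ℝ) (N : ℕ) (ε : ℝ) : Fin N → Measure ℝ := fun _ =>
  (2⁻¹ : ℝ≥0∞) • Measure.dirac (1 / (N : ℝ) + ε * (N : ℝ) ^ (-(1 / p))) +
  (2⁻¹ : ℝ≥0∞) • Measure.dirac (1 / (N : ℝ) - ε * (N : ℝ) ^ (-(1 / p)))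

/-- `Δ_m(π)`, the shift of the mean of the histogram ordinate `X_m = #{i : O_i = m}` caused by the
prior `π`. -/
def meanShift (n : ℝ) {N : ℕ} (π : Fin N → Measure ℝ) (m : ℕ) : ℝ :=
  poisMass (n / N) m * ∑ i, ∫ t, hFun m (n / N) (n * (t - 1 / (N : ℝ))) ∂(π i)

/-- `Σ = diag(μ⁰) - μ⁰ μ⁰ᵀ / N` with `μ⁰_m = N P_{n/N}(m)`, the covariance of the histogram
`(X_m)` under the null. -/
def histCov (N : ℕ) (n : ℝ) (m k : ℕ) : ℝ :=
  (if m = k then (N : ℝ) * poisMass (n / N) m else 0) -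
    ((N : ℝ) * poisMass (n / N) m) * ((N : ℝ) * poisMass (n / N) k) / (N : ℝ)

/-- The weights of the linear histogram statistics `T(w) = ∑_m w_m X_m`: non-constant sequences of
at most exponential growth. -/
def IsWeight (w : ℕ → ℝ) : Prop :=
  (∃ C : ℝ, 0 < C ∧ ∀ m : ℕ, |w m| ≤ Real.exp (C * ((m : ℝ) + 1))) ∧ ¬ ∃ c : ℝ, ∀ m, w m = c

/-- The standardized mean shift `⟨w, Δ(π)⟩ / √⟨w, Σ w⟩` of `T(w)` under the prior `π`. -/
def linShift (n : ℝ) {N : ℕ} (w : ℕ → ℝ) (π : Fin N → Measure ℝ) : ℝ :=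
  (∑' m : ℕ, w m * meanShift n π m) /
    Real.sqrt (∑' m : ℕ, w m * ∑' k : ℕ, histCov N n m k * w k)

/-- The weights `w*_m = Δ_m(π*) / μ⁰_m`, where `π*` is the two-point prior. They are equal to
`g_{m,n/N}(n ε N^{-1/p})`. -/
def optWeight (p : ℝ) (N : ℕ) (n ε : ℝ) (m : ℕ) : ℝ :=
  meanShift n (twoPointPrior p N ε) m / ((N : ℝ) * poisMass (n / N) m)

/-- The asymptotic power, under the prior `π`, of the test that rejects when the standardized
statistic `(T(w) - ⟨w, μ⁰⟩) / √⟨w, Σ w⟩` exceeds `z`. -/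
def linPower (n : ℝ) {N : ℕ} (w : ℕ → ℝ) (z : ℝ) (π : Fin N → Measure ℝ) : ℝ :=
  stdNormalCDF (linShift n w π - z)

end PoissonUniformity

end

/-! # Minimax testing of uniformity for Poisson counts

Put `lam = n / N`, let `a = N ^ (1 - 1 / p) * ε ≤ ξ` be the common relative size of the perturbations
in the two-point prior, and let `g m = gFun m lam (lam * a)`. Everything rests on one identity: if
`O ~ Pois(lam)`, then `1 + hFun O lam x` is a likelihood ratio, so that
`E[(1 + hFun O lam x) (1 + hFun O lam y)] = exp (x y / lam)`. It follows that the score statistic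
`T = ∑ i, g (O i)` has mean `0` and variance `u² = N (cosh (lam a²) - 1)` under the null, and mean
`∑ i, (cosh (lam a c_i) - 1)` under the rates `lam (1 + c_i)`.

*Lower bound.* The likelihood ratio between the mixture over the signs of the perturbations `± a` and
the null is `L = ∏ i, (1 + g (O i))`, and by Neyman–Pearson every test has Bayes risk at least that
of the test `1 ≤ L`. As `ξ → 0` the fourth moment of `g` is of smaller order than its variance, so
`log L = T - u² / 2 + o(1)` in probability while `u` stays bounded, and `T` is asymptotically
`N(0, u²)` under the null and `N(u², u²)` under each choice of the signs
(`exists_likelihoodTest_errors_ge`). For small `u` the chi-square bound gives a risk close to `1`,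
and for large `u` there is nothing to show.

*Upper bound.* The test `T > u² / 2` has asymptotic error `Φ(-u / 2)` under the null. Under an
alternative, `cosh (b |c|)` lies above its tangent at `|c| = a` as a function of `|c| ^ p`, because
`p ≤ 2` makes it a constant plus a series with non-negative coefficients in the powers of `|c| ^ p`
with real exponents `2 k / p ≥ 1`, `k ≥ 1`. Summing the tangent inequality (`exists_cosh_tangent_rpow`) over the coordinates shows
that the mean of `T` is at least `u²` on the whole alternative (`nullVar_le_scoreMean`). If that mean
is bounded, `T` is asymptotically normal with variance close to `u²`, and otherwise Chebyshev's
inequality applies (`exists_scoreTest_errors_le`). For small `u` the test that always rejects, whose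
risk is `1`, is good enough.

The normal approximations must be uniform in all parameters. They come from a quantitative form of
the central limit theorem (`exists_normal_approx`), obtained by contradiction from Lévy's continuity
theorem: a violating sequence of product laws would have characteristic functions converging to the
Gaussian one. Only `ξ → 0` and the bound on `lam` are needed: no lower bound on `n` or `N` enters,
because a bounded `N` forces `u → 0`.

*Linear histogram tests.* The optimal weights `w*` are `g`. Since `⟨w, Δ(π*)⟩ = N E[w g]` and
`⟨w, Σ w⟩ = N Var w` under `Pois(lam)`, optimality of `w*` against `π*` is the Cauchy–Schwarz
inequality. For any other prior, `⟨w*, Δ(π)⟩` is the integral of `∑ i, (cosh (lam a c_i) - 1)`, and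
integrating the tangent inequality gives `⟨w*, Δ(π)⟩ ≥ u²`, with equality at `π*`.
-/

noncomputable section

namespace PoissonUniformity

/-! ### Exponential moments of Poisson laws -/

lemma integrable_pow_poisson (r : NNReal) (s : ℝ) :
    Integrable (fun m : ℕ => s ^ m) (poissonMeasure r) := by
  rw [integrable_poissonMeasure_iff]
  have h := (Real.summable_pow_div_factorial (r * |s|)).mul_left (Real.exp (-r))
  refine h.congr fun m => ?_
  rw [norm_pow, Real.norm_eq_abs, mul_pow]; ring

lemma integral_pow_poisson (r : NNReal) (s : ℝ) :
    ∫ m : ℕ, s ^ m ∂poissonMeasure r = Real.exp (r * (s - 1)) := by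
  rw [integral_poissonMeasure]
  have h := (NormedSpace.expSeries_div_hasSum_exp ((r : ℝ) * s)).mul_left (Real.exp (-r))
  rw [← Real.exp_eq_exp_ℝ, ← Real.exp_add] at h
  rw [show (r : ℝ) * (s - 1) = -r + r * s by ring, ← h.tsum_eq]
  refine tsum_congr fun m => ?_
  rw [smul_eq_mul, mul_pow]; ring

/-- Functions of at most exponential growth are integrable for every Poisson law. -/
lemma integrable_poisson_of_le_pow (r : NNReal) {f : ℕ → ℝ} {A s : ℝ}
    (h : ∀ m, |f m| ≤ A * s ^ m) : Integrable f (poissonMeasure r) :=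
  ((integrable_pow_poisson r s).const_mul A).mono' (by fun_prop)
    (Filter.Eventually.of_forall h)

lemma gFun_mul {lam : ℝ} (hl : lam ≠ 0) (a : ℝ) (m : ℕ) :
    gFun m lam (lam * a) =
      (Real.exp (-(lam * a)) * (1 + a) ^ m + Real.exp (lam * a) * (1 - a) ^ m) / 2 - 1 := by
  unfold gFun hFun
  have h1 : 1 + lam * a / lam = 1 + a := by field_simp
  have h2 : 1 + -(lam * a) / lam = 1 - a := by field_simp; ring
  rw [h1, h2, neg_neg]; ring

lemma hFun_mul {lam : ℝ} (hl : lam ≠ 0) (c : ℝ) (m : ℕ) :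
    hFun m lam (lam * c) = Real.exp (-(lam * c)) * (1 + c) ^ m - 1 := by
  unfold hFun
  have h1 : 1 + lam * c / lam = 1 + c := by field_simp
  rw [h1]

/-- `1 + h_{m,lam}(lam c)` is the likelihood ratio of the Poisson laws of rates `lam (1 + c)`
and `lam`. -/
lemma poisMass_mul_one_add_hFun {lam : ℝ} (hl : lam ≠ 0) (c : ℝ) (m : ℕ) :
    poisMass lam m * (1 + hFun m lam (lam * c)) = poisMass (lam * (1 + c)) m := by
  rw [hFun_mul hl]
  unfold poisMass
  rw [show -(lam * (1 + c)) = -lam + -(lam * c) by ring, Real.exp_add, mul_pow]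
  ring

/-- The function `m ↦ g_{m,lam}(lam a)` grows at most exponentially. -/
lemma abs_gFun_le {lam a : ℝ} (hl : 0 < lam) (ha : 0 < a) (ha1 : a ≤ 1) (m : ℕ) :
    |gFun m lam (lam * a)| ≤ (Real.exp lam + 1) * 2 ^ m := by
  rw [gFun_mul hl.ne']
  have hla : lam * a ≤ lam := by nlinarith
  have hla0 : 0 < lam * a := by positivity
  have e1 : Real.exp (-(lam * a)) ≤ Real.exp lam := Real.exp_le_exp.2 (by linarith)
  have e2 : Real.exp (lam * a) ≤ Real.exp lam := Real.exp_le_exp.2 hla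
  have p1 : (1 + a) ^ m ≤ 2 ^ m := pow_le_pow_left₀ (by linarith) (by linarith) m
  have p2 : (1 - a) ^ m ≤ 2 ^ m := pow_le_pow_left₀ (by linarith) (by linarith) m
  have p1' : 0 ≤ (1 + a) ^ m := pow_nonneg (by linarith) m
  have p2' : 0 ≤ (1 - a) ^ m := pow_nonneg (by linarith) m
  have p3 : (1 : ℝ) ≤ 2 ^ m := one_le_pow₀ (by norm_num)
  have q1 := mul_le_mul e1 p1 p1' (Real.exp_pos _).le
  have q2 := mul_le_mul e2 p2 p2' (Real.exp_pos _).le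
  have q1' := mul_nonneg (Real.exp_pos (-(lam * a))).le p1'
  have q2' := mul_nonneg (Real.exp_pos (lam * a)).le p2'
  have q3 : 0 < Real.exp lam * 2 ^ m := by positivity
  rw [abs_le]
  constructor <;> nlinarith

lemma integrable_gFun_pow (r : NNReal) {lam a : ℝ} (hl : 0 < lam) (ha : 0 < a) (ha1 : a ≤ 1)
    (k : ℕ) : Integrable (fun m => gFun m lam (lam * a) ^ k) (poissonMeasure r) := by
  refine integrable_poisson_of_le_pow r (A := (Real.exp lam + 1) ^ k) (s := 2 ^ k) fun m => ?_
  rw [abs_pow, ← pow_mul, mul_comm k m, pow_mul, ← mul_pow]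
  exact pow_le_pow_left₀ (abs_nonneg _) (abs_gFun_le hl ha ha1 m) k

lemma integrable_gFun (r : NNReal) {lam a : ℝ} (hl : 0 < lam) (ha : 0 < a) (ha1 : a ≤ 1) :
    Integrable (fun m => gFun m lam (lam * a)) (poissonMeasure r) := by
  simpa using integrable_gFun_pow r hl ha ha1 1

lemma integral_gFun {lam : ℝ} (hl : 0 < lam) (a : ℝ) {c : ℝ} (hc : -1 ≤ c) :
    ∫ m, gFun m lam (lam * a) ∂poissonMeasure (Real.toNNReal (lam * (1 + c))) =
      Real.cosh (lam * a * c) - 1 := by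
  have hr : ((Real.toNNReal (lam * (1 + c)) : NNReal) : ℝ) = lam * (1 + c) :=
    Real.coe_toNNReal _ (mul_nonneg hl.le (by linarith))
  simp_rw [gFun_mul hl.ne']
  rw [integral_sub (((((integrable_pow_poisson _ _).const_mul _).fun_add
      ((integrable_pow_poisson _ _).const_mul _))).div_const 2) (integrable_const _),
    integral_div, integral_add ((integrable_pow_poisson _ _).const_mul _)
      ((integrable_pow_poisson _ _).const_mul _), integral_const_mul, integral_const_mul,
    integral_pow_poisson, integral_pow_poisson, hr, ← Real.exp_add, ← Real.exp_add, Real.cosh_eq]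
  simp only [integral_const, probReal_univ, smul_eq_mul, mul_one]
  ring_nf

lemma integral_gFun_sq {lam : ℝ} (hl : 0 < lam) (a : ℝ) {c : ℝ} (hc : -1 ≤ c) :
    ∫ m, gFun m lam (lam * a) ^ 2 ∂poissonMeasure (Real.toNNReal (lam * (1 + c))) =
      (Real.cosh (lam * a ^ 2 * (1 + c)) - 1) +
        2 * (Real.exp (lam * a ^ 2 * (1 + c)) - 1) * (Real.cosh (lam * a * c) - 1) +
        Real.exp (lam * a ^ 2 * (1 + c)) * (Real.cosh (lam * a * c) - 1) ^ 2 := by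
  have hr : ((Real.toNNReal (lam * (1 + c)) : NNReal) : ℝ) = lam * (1 + c) :=
    Real.coe_toNNReal _ (mul_nonneg hl.le (by linarith))
  have key : ∀ m, gFun m lam (lam * a) ^ 2 =
      (Real.exp (-(2 * lam * a)) * ((1 + a) ^ 2) ^ m +
        Real.exp (2 * lam * a) * ((1 - a) ^ 2) ^ m) / 4 + (1 - a ^ 2) ^ m / 2
        - (2 * gFun m lam (lam * a) + 1) := by
    intro m
    rw [gFun_mul hl.ne', show -(2 * lam * a) = -(lam * a) + -(lam * a) by ring,
      show 2 * lam * a = lam * a + lam * a by ring, Real.exp_add, Real.exp_add,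
      show (1 - a ^ 2) = (1 + a) * (1 - a) by ring, mul_pow, ← pow_mul, ← pow_mul, mul_comm 2 m,
      pow_mul, pow_mul]
    have : Real.exp (-(lam * a)) * Real.exp (lam * a) = 1 := by
      rw [← Real.exp_add]; simp
    linear_combination ((1 + a) ^ m * (1 - a) ^ m / 2) * this
  have i1 := fun s : ℝ => integrable_pow_poisson (Real.toNNReal (lam * (1 + c))) s
  have ig : Integrable (fun m => gFun m lam (lam * a))
      (poissonMeasure (Real.toNNReal (lam * (1 + c)))) := by
    simp_rw [gFun_mul hl.ne']
    exact ((((i1 _).const_mul _).fun_add ((i1 _).const_mul _)).div_const 2).sub (integrable_const _)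
  simp_rw [key]
  rw [integral_sub (((((i1 _).const_mul _).fun_add ((i1 _).const_mul _)).div_const 4).fun_add
      ((i1 _).div_const 2)) ((ig.const_mul 2).fun_add (integrable_const _)),
    integral_add ((((i1 _).const_mul _).fun_add ((i1 _).const_mul _)).div_const 4)
      ((i1 _).div_const 2), integral_add (ig.const_mul 2) (integrable_const _),
    integral_div, integral_div, integral_add ((i1 _).const_mul _) ((i1 _).const_mul _),
    integral_const_mul, integral_const_mul, integral_const_mul, integral_gFun hl a hc,
    integral_pow_poisson, integral_pow_poisson, integral_pow_poisson, hr, ← Real.exp_add,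
    ← Real.exp_add]
  simp only [integral_const, probReal_univ, smul_eq_mul, mul_one]
  have e1 : -(2 * lam * a) + lam * (1 + c) * ((1 + a) ^ 2 - 1) =
      lam * a ^ 2 * (1 + c) + lam * a * c + lam * a * c := by ring
  have e2 : 2 * lam * a + lam * (1 + c) * ((1 - a) ^ 2 - 1) =
      lam * a ^ 2 * (1 + c) + -(lam * a * c) + -(lam * a * c) := by ring
  have e3 : lam * (1 + c) * (1 - a ^ 2 - 1) = -(lam * a ^ 2 * (1 + c)) := by ring
  rw [e1, e2, e3, Real.cosh_eq, Real.cosh_eq]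
  simp only [Real.exp_add]
  have : Real.exp (-(lam * a * c)) * Real.exp (lam * a * c) = 1 := by
    rw [← Real.exp_add]; simp
  linear_combination (-Real.exp (lam * a ^ 2 * (1 + c)) / 2) * this

/-- Under the null the second moment of `g` is `cosh (lam a²) - 1`. -/
lemma integral_gFun_sq_null {lam : ℝ} (hl : 0 < lam) (a : ℝ) :
    ∫ m, gFun m lam (lam * a) ^ 2 ∂poissonMeasure (Real.toNNReal lam) =
      Real.cosh (lam * a ^ 2) - 1 := by
  have h := integral_gFun_sq hl a (c := 0) (by norm_num)
  simpa using h

lemma integral_gFun_null {lam : ℝ} (hl : 0 < lam) (a : ℝ) :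
    ∫ m, gFun m lam (lam * a) ∂poissonMeasure (Real.toNNReal lam) = 0 := by
  have h := integral_gFun hl a (c := 0) (by norm_num)
  simpa using h

/-! ### Elementary bounds for hyperbolic functions -/

lemma sinh_le_mul_exp {x : ℝ} : Real.sinh x ≤ x * Real.exp x := by
  have h := Real.add_one_le_exp (-2 * x)
  have h2 : Real.exp (-x) = Real.exp x * Real.exp (-2 * x) := by
    rw [← Real.exp_add]; ring_nf
  rw [Real.sinh_eq, h2]
  nlinarith [Real.exp_pos x]

lemma cosh_sub_one_eq (x : ℝ) : Real.cosh x - 1 = 2 * Real.sinh (x / 2) ^ 2 := by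
  have h := Real.cosh_two_mul (x / 2)
  rw [show 2 * (x / 2) = x by ring, Real.cosh_sq] at h
  linarith

lemma cosh_sub_one_nonneg (x : ℝ) : 0 ≤ Real.cosh x - 1 := by
  linarith [Real.one_le_cosh x]

lemma cosh_sub_one_le (x : ℝ) : Real.cosh x - 1 ≤ x ^ 2 * Real.exp |x| / 2 := by
  rw [← Real.cosh_abs, ← sq_abs, cosh_sub_one_eq]
  have h0 : 0 ≤ Real.sinh (|x| / 2) := Real.sinh_nonneg_iff.2 (by positivity)
  have h := pow_le_pow_left₀ h0 (sinh_le_mul_exp (x := |x| / 2)) 2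
  have e : Real.exp (|x| / 2) ^ 2 = Real.exp |x| := by
    rw [← Real.exp_nat_mul]; push_cast; ring_nf
  rw [mul_pow, e] at h
  nlinarith

lemma half_sq_le_cosh_sub_one (x : ℝ) : x ^ 2 / 2 ≤ Real.cosh x - 1 := by
  rw [← Real.cosh_abs, ← sq_abs, cosh_sub_one_eq]
  have h := pow_le_pow_left₀ (by positivity)
    (Real.self_le_sinh_iff.2 (by positivity : 0 ≤ |x| / 2)) 2
  nlinarith

lemma cosh_le_exp_of_nonneg {x : ℝ} (hx : 0 ≤ x) : Real.cosh x ≤ Real.exp x := by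
  have h := Real.exp_le_exp.2 (show -x ≤ x by linarith)
  rw [Real.cosh_eq]; linarith

lemma exp_sub_one_le_mul_exp (x : ℝ) : Real.exp x - 1 ≤ x * Real.exp x := by
  have h := Real.add_one_le_exp (-x)
  have h2 : Real.exp x * Real.exp (-x) = 1 := by rw [← Real.exp_add]; simp
  nlinarith [Real.exp_pos x]

lemma abs_cosh_mul_one_add_sub_le {b c : ℝ} (hb : 0 ≤ b) (hc : |c| ≤ 1) :
    |Real.cosh (b * (1 + c)) - Real.cosh b| ≤
      3 * Real.exp (2 * b) * |c| * (Real.cosh b - 1) := by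
  set ω := Real.cosh b - 1 with hω
  have hω0 : 0 ≤ ω := cosh_sub_one_nonneg b
  have hcb : |b * c| ≤ b := by
    rw [abs_mul, abs_of_nonneg hb]; nlinarith
  have he : Real.exp |b * c| ≤ Real.exp b := Real.exp_le_exp.2 hcb
  have hE1 : 1 ≤ Real.exp b := Real.one_le_exp hb
  have hcosh : Real.cosh b ≤ Real.exp b := cosh_le_exp_of_nonneg hb
  have hbs : b ≤ Real.sinh b := Real.self_le_sinh_iff.2 hb
  have h1 : Real.cosh (b * c) - 1 ≤ |c| * Real.exp b * ω := by
    calc _ ≤ (b * c) ^ 2 * Real.exp |b * c| / 2 := cosh_sub_one_le _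
      _ ≤ (b * c) ^ 2 * Real.exp b / 2 := by gcongr
      _ = |c| ^ 2 * Real.exp b * (b ^ 2 / 2) := by rw [sq_abs]; ring
      _ ≤ |c| * Real.exp b * (b ^ 2 / 2) := by
          gcongr; exact pow_le_of_le_one (abs_nonneg _) hc (by norm_num)
      _ ≤ |c| * Real.exp b * ω := by gcongr; exact half_sq_le_cosh_sub_one b
  have h2 : |Real.sinh (b * c)| ≤ |c| * Real.exp b * Real.sinh b := by
    rw [Real.abs_sinh]
    calc _ ≤ |b * c| * Real.exp |b * c| := sinh_le_mul_exp
      _ ≤ |b * c| * Real.exp b := by gcongr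
      _ = |c| * Real.exp b * b := by rw [abs_mul, abs_of_nonneg hb]; ring
      _ ≤ _ := by gcongr
  have hs2 : Real.sinh b ^ 2 = ω * (Real.cosh b + 1) := by
    have := Real.cosh_sq b
    rw [hω]; linarith [this]
  have h0 : 0 ≤ Real.cosh (b * c) - 1 := cosh_sub_one_nonneg _
  have hsb : 0 ≤ Real.sinh b := Real.sinh_nonneg_iff.2 hb
  calc |Real.cosh (b * (1 + c)) - Real.cosh b|
      = |Real.cosh b * (Real.cosh (b * c) - 1) + Real.sinh b * Real.sinh (b * c)| := by
        rw [show b * (1 + c) = b + b * c by ring, Real.cosh_add]; ring_nf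
    _ ≤ Real.cosh b * (Real.cosh (b * c) - 1) + Real.sinh b * |Real.sinh (b * c)| := by
        refine (abs_add_le _ _).trans_eq ?_
        rw [abs_mul, abs_mul, abs_of_nonneg h0, abs_of_nonneg hsb,
          abs_of_nonneg (Real.cosh_pos b).le]
    _ ≤ Real.exp b * (|c| * Real.exp b * ω) + Real.sinh b * (|c| * Real.exp b * Real.sinh b) := by
        gcongr
    _ = |c| * ω * Real.exp b * (Real.exp b + (Real.cosh b + 1)) := by
        linear_combination (|c| * Real.exp b) * hs2
    _ ≤ |c| * ω * Real.exp b * (3 * Real.exp b) := by gcongr; linarith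
    _ = _ := by rw [two_mul b, Real.exp_add]; ring

/-! ### Moments of the score `g` near the null -/

/-- The two terms of the bound reflect that `g_{m,lam}(lam a)` is of order `a²` for `m ≥ 2`, but
of order `lam a²` for `m ≤ 1`. -/
lemma abs_gFun_le_sq {M lam a : ℝ} (hl : 0 < lam) (hM : lam ≤ M) (ha : 0 < a) (ha1 : a ≤ 1)
    (m : ℕ) : |gFun m lam (lam * a)| ≤
      (M + 1) * Real.exp M * a ^ 2 * (2 ^ m * (lam + if 2 ≤ m then 1 else 0)) := by
  have hM0 : 0 < M := hl.trans_le hM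
  set e : ℝ := ((1 + a) ^ m + (1 - a) ^ m) / 2 with he
  set o : ℝ := ((1 + a) ^ m - (1 - a) ^ m) / 2 with ho
  have hG : gFun m lam (lam * a) =
      (Real.cosh (lam * a) - 1) * e - Real.sinh (lam * a) * o + (e - 1) := by
    rw [gFun_mul hl.ne', Real.cosh_eq, Real.sinh_eq, he, ho]; ring
  have hind : ∀ k : ℕ, 1 ≤ ((1 + a) ^ k + (1 - a) ^ k) / 2 ∧
      ((1 + a) ^ k + (1 - a) ^ k) / 2 - 1 ≤ a ^ 2 * (2 ^ k * if 2 ≤ k then 1 else 0) ∧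
      0 ≤ ((1 + a) ^ k - (1 - a) ^ k) / 2 ∧ ((1 + a) ^ k - (1 - a) ^ k) / 2 ≤ a * 2 ^ k := by
    intro k
    induction k with
    | zero => norm_num; positivity
    | succ k ih =>
      obtain ⟨h1, h2, h3, h4⟩ := ih
      have s1 : ((1 + a) ^ (k + 1) + (1 - a) ^ (k + 1)) / 2 =
        ((1 + a) ^ k + (1 - a) ^ k) / 2 + a * (((1 + a) ^ k - (1 - a) ^ k) / 2) := by ring
      have s2 : ((1 + a) ^ (k + 1) - (1 - a) ^ (k + 1)) / 2 =
        ((1 + a) ^ k - (1 - a) ^ k) / 2 + a * (((1 + a) ^ k + (1 - a) ^ k) / 2) := by ring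
      have h5 : ((1 + a) ^ k + (1 - a) ^ k) / 2 ≤ 2 ^ k := by
        have p1 : (1 + a) ^ k ≤ 2 ^ k := pow_le_pow_left₀ (by linarith) (by linarith) k
        have p2 : (1 - a) ^ k ≤ 2 ^ k := pow_le_pow_left₀ (by linarith) (by linarith) k
        linarith
      have hp : (0 : ℝ) < 2 ^ k := by positivity
      rw [s1, s2]
      refine ⟨by nlinarith, ?_, by nlinarith, ?_⟩
      · rcases Nat.eq_zero_or_pos k with rfl | hk
        · simp
        · rw [if_pos (by omega)]
          have h2' : ((1 + a) ^ k + (1 - a) ^ k) / 2 - 1 ≤ a ^ 2 * 2 ^ k := by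
            refine h2.trans ?_
            split_ifs
            · simp
            · simp; positivity
          have ho4 := mul_le_mul_of_nonneg_left h4 ha.le
          rw [pow_succ 2 k]; linarith
      · have he5 := mul_le_mul_of_nonneg_left h5 ha.le
        rw [pow_succ 2 k]; linarith
  obtain ⟨h1, h2, h3, h4⟩ := hind m
  rw [← he] at h1 h2
  rw [← ho] at h3 h4
  have h5 : e ≤ 2 ^ m := by
    have p1 : (1 + a) ^ m ≤ 2 ^ m := pow_le_pow_left₀ (by linarith) (by linarith) m
    have p2 : (1 - a) ^ m ≤ 2 ^ m := pow_le_pow_left₀ (by linarith) (by linarith) m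
    rw [he]; linarith
  have hla : lam * a ≤ M := by nlinarith
  have hla0 : 0 < lam * a := by positivity
  have hE : Real.exp (lam * a) ≤ Real.exp M := Real.exp_le_exp.2 hla
  have hE1 : 1 ≤ Real.exp M := Real.one_le_exp hM0.le
  have hs0 : 0 ≤ Real.sinh (lam * a) := Real.sinh_nonneg_iff.2 hla0.le
  have hs : Real.sinh (lam * a) ≤ lam * a * Real.exp M :=
    sinh_le_mul_exp.trans (by gcongr)
  have hc : Real.cosh (lam * a) - 1 ≤ M * lam * a ^ 2 * Real.exp M := by
    have := cosh_sub_one_le (lam * a)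
    rw [abs_of_pos hla0] at this
    calc _ ≤ _ := this
      _ ≤ (lam * a) ^ 2 * Real.exp M / 2 := by gcongr
      _ = lam * lam * a ^ 2 * Real.exp M / 2 := by ring
      _ ≤ M * lam * a ^ 2 * Real.exp M / 2 := by gcongr
      _ ≤ _ := half_le_self (by positivity)
  have hc0 := cosh_sub_one_nonneg (lam * a)
  have ha2 : 0 ≤ a ^ 2 := sq_nonneg a
  set I : ℝ := if 2 ≤ m then 1 else 0 with hI
  have hI0 : 0 ≤ I := by rw [hI]; split_ifs <;> norm_num
  have t1 : (Real.cosh (lam * a) - 1) * e ≤ M * lam * a ^ 2 * Real.exp M * 2 ^ m := by gcongr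
  have t2 : Real.sinh (lam * a) * o ≤ lam * a * Real.exp M * (a * 2 ^ m) := by gcongr
  have t3 : e - 1 ≤ (M + 1) * Real.exp M * (a ^ 2 * (2 ^ m * I)) := by
    refine h2.trans (le_mul_of_one_le_left (by positivity) ?_)
    nlinarith
  have t1' : 0 ≤ (Real.cosh (lam * a) - 1) * e := by positivity
  have t2' : 0 ≤ Real.sinh (lam * a) * o := by positivity
  calc |gFun m lam (lam * a)|
      ≤ (Real.cosh (lam * a) - 1) * e + Real.sinh (lam * a) * o + (e - 1) := by
        rw [hG, abs_le]; constructor <;> linarith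
    _ ≤ M * lam * a ^ 2 * Real.exp M * 2 ^ m + lam * a * Real.exp M * (a * 2 ^ m) +
        (M + 1) * Real.exp M * (a ^ 2 * (2 ^ m * I)) := by linarith
    _ = _ := by ring

/-- The fourth moment of `g` is of smaller order than its second moment, because the null second
moment is at least `(lam a²)² / 2`. -/
lemma exists_integral_gFun_pow_four_le {M : ℝ} (hM0 : 0 < M) :
    ∃ C : ℝ, 0 < C ∧ ∀ lam a c : ℝ, 0 < lam → lam ≤ M → 0 < a → a ≤ 1 → |c| ≤ 1 →
      ∫ m, gFun m lam (lam * a) ^ 4 ∂poissonMeasure (Real.toNNReal (lam * (1 + c))) ≤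
        C * a * (Real.cosh (lam * a ^ 2) - 1) := by
  set D := (M + 1) * Real.exp M with hD
  have hDpos : 0 < D := by positivity
  set K := Real.exp (30 * M) * (M ^ 2 + (32 * Real.exp (32 * M)) ^ 2 / 2) with hK
  have hKpos : 0 < K := by positivity
  refine ⟨16 * D ^ 4 * K, by positivity, fun lam a c hl hM ha ha1 hc => ?_⟩
  obtain ⟨hc1, hc2⟩ := abs_le.1 hc
  set r := Real.toNNReal (lam * (1 + c)) with hrdef
  have hr : (r : ℝ) = lam * (1 + c) := Real.coe_toNNReal _ (mul_nonneg hl.le (by linarith))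
  have hr0 : 0 ≤ lam * (1 + c) := mul_nonneg hl.le (by linarith)
  have hr2 : lam * (1 + c) ≤ 2 * lam := by nlinarith
  -- `(3 ^ m - 2 * 2 ^ m + 1) / 2` vanishes at `m = 0, 1` and is at least `1` for `m ≥ 2`
  have hpt : ∀ m : ℕ, gFun m lam (lam * a) ^ 4 ≤ 8 * D ^ 4 * a ^ 8 *
      (lam ^ 4 * 16 ^ m + (48 ^ m - 2 * 32 ^ m + 16 ^ m) / 2) := by
    intro m
    have hI : (if 2 ≤ m then (1 : ℝ) else 0) ≤ (3 ^ m - 2 * 2 ^ m + 1) / 2 := by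
      split_ifs with h
      · obtain ⟨k, rfl⟩ := Nat.exists_eq_add_of_le h
        have h2 : (1 : ℝ) ≤ 2 ^ k := one_le_pow₀ (by norm_num)
        have h3 : (2 : ℝ) ^ k ≤ 3 ^ k := pow_le_pow_left₀ (by norm_num) (by norm_num) k
        rw [pow_add, pow_add]; linarith
      · interval_cases m <;> norm_num
    set I := (if 2 ≤ m then (1 : ℝ) else 0) with hIdef
    have hI4 : I ^ 4 = I := by rw [hIdef]; split_ifs <;> norm_num
    have hI0 : 0 ≤ I := by rw [hIdef]; split_ifs <;> norm_num
    have h1 : gFun m lam (lam * a) ^ 4 ≤ (D * a ^ 2 * (2 ^ m * (lam + I))) ^ 4 := by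
      rw [← Even.pow_abs (by decide : Even 4)]
      exact pow_le_pow_left₀ (abs_nonneg _) (abs_gFun_le_sq hl hM ha ha1 m) 4
    have h2 : (lam + I) ^ 4 ≤ 8 * (lam ^ 4 + I) := by
      have := add_pow_le hl.le hI0 4
      rw [hI4] at this
      norm_num at this
      exact this
    have e16 : ((2 : ℝ) ^ m) ^ 4 = 16 ^ m := by rw [← pow_mul, mul_comm, pow_mul]; norm_num
    have e48 : (48 : ℝ) ^ m = 16 ^ m * 3 ^ m := by rw [← mul_pow]; norm_num
    have e32 : (32 : ℝ) ^ m = 16 ^ m * 2 ^ m := by rw [← mul_pow]; norm_num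
    calc _ ≤ _ := h1
      _ = D ^ 4 * a ^ 8 * (16 ^ m * (lam + I) ^ 4) := by rw [← e16]; ring
      _ ≤ D ^ 4 * a ^ 8 * (16 ^ m * (8 * (lam ^ 4 + (3 ^ m - 2 * 2 ^ m + 1) / 2))) := by
          gcongr; exact h2.trans (by gcongr)
      _ = _ := by rw [e48, e32]; ring
  have i1 := fun s : ℝ => integrable_pow_poisson r s
  have i2 : Integrable (fun m : ℕ => (48 : ℝ) ^ m - 2 * 32 ^ m) (poissonMeasure r) :=
    (i1 48).sub ((i1 32).const_mul 2)
  have i3 : Integrable (fun m : ℕ => ((48 : ℝ) ^ m - 2 * 32 ^ m + 16 ^ m) / 2)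
      (poissonMeasure r) := (i2.fun_add (i1 16)).div_const 2
  have hint : ∫ m, gFun m lam (lam * a) ^ 4 ∂poissonMeasure r ≤ 8 * D ^ 4 * a ^ 8 *
      (lam ^ 4 * Real.exp (15 * (lam * (1 + c))) + Real.exp (15 * (lam * (1 + c))) *
        (Real.exp (16 * (lam * (1 + c))) - 1) ^ 2 / 2) := by
    refine (integral_mono (integrable_gFun_pow r hl ha ha1 4)
      ((((i1 16).const_mul (lam ^ 4)).fun_add i3).const_mul (8 * D ^ 4 * a ^ 8)) hpt).trans_eq ?_
    rw [integral_const_mul, integral_add ((i1 16).const_mul _) i3, integral_const_mul,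
      integral_div, integral_add i2 (i1 16), integral_sub (i1 48) ((i1 32).const_mul 2),
      integral_const_mul, integral_pow_poisson, integral_pow_poisson, integral_pow_poisson, hr,
      show lam * (1 + c) * (48 - 1) = 15 * (lam * (1 + c)) + 16 * (lam * (1 + c)) +
        16 * (lam * (1 + c)) by ring,
      show lam * (1 + c) * (32 - 1) = 15 * (lam * (1 + c)) + 16 * (lam * (1 + c)) by ring,
      show lam * (1 + c) * (16 - 1) = 15 * (lam * (1 + c)) by ring]
    simp only [Real.exp_add]
    ring
  have hb : Real.exp (15 * (lam * (1 + c))) ≤ Real.exp (30 * M) :=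
    Real.exp_le_exp.2 (by linarith)
  have hx : Real.exp (16 * (lam * (1 + c))) - 1 ≤ 32 * Real.exp (32 * M) * lam := by
    calc _ ≤ 16 * (lam * (1 + c)) * Real.exp (16 * (lam * (1 + c))) := exp_sub_one_le_mul_exp _
      _ ≤ 16 * (2 * lam) * Real.exp (32 * M) := by
          refine mul_le_mul (by linarith) (Real.exp_le_exp.2 (by linarith))
            (Real.exp_pos _).le (by linarith)
      _ = _ := by ring
  have hx0 : 0 ≤ Real.exp (16 * (lam * (1 + c))) - 1 := by
    linarith [Real.one_le_exp (by linarith : 0 ≤ 16 * (lam * (1 + c)))]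
  have hω := half_sq_le_cosh_sub_one (lam * a ^ 2)
  calc _ ≤ _ := hint
    _ ≤ 8 * D ^ 4 * a ^ 8 * (M ^ 2 * lam ^ 2 * Real.exp (30 * M) + Real.exp (30 * M) *
        (32 * Real.exp (32 * M) * lam) ^ 2 / 2) := by
        have : lam ^ 4 ≤ M ^ 2 * lam ^ 2 := by
          rw [show lam ^ 4 = lam ^ 2 * lam ^ 2 by ring]; gcongr
        gcongr
    _ = 16 * D ^ 4 * K * a ^ 4 * ((lam * a ^ 2) ^ 2 / 2) := by rw [hK]; ring
    _ ≤ 16 * D ^ 4 * K * a * (Real.cosh (lam * a ^ 2) - 1) := by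
        gcongr
        exact pow_le_of_le_one ha.le ha1 (by norm_num)

/-- Uniform control of the moments of `g` at rates `lam (1 + c)` with `|c| ≤ ξ`: up to an error
of relative order `ξ`, the second moment and the variance agree with the null variance
`ω = cosh (lam a²) - 1`, and the fourth moments are negligible. The error is measured in terms of
`ω` and of the mean `v = cosh (lam a c) - 1`. -/
lemma exists_moment_bounds {M : ℝ} (hM0 : 0 < M) :
    ∃ C : ℝ, 0 < C ∧ ∀ lam a c ξ : ℝ, 0 < lam → lam ≤ M → 0 < a → a ≤ ξ → ξ ≤ 1 → |c| ≤ ξ →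
      ∀ P ω v, P = poissonMeasure (Real.toNNReal (lam * (1 + c))) →
        ω = Real.cosh (lam * a ^ 2) - 1 → v = Real.cosh (lam * a * c) - 1 →
      |∫ m, gFun m lam (lam * a) ^ 2 ∂P - ω| ≤ C * ξ * (ω + v) ∧
      |∫ m, (gFun m lam (lam * a) - v) ^ 2 ∂P - ω| ≤ C * ξ * (ω + v) ∧
      ∫ m, gFun m lam (lam * a) ^ 4 ∂P ≤ C * ξ * (ω + v) ∧
      ∫ m, (gFun m lam (lam * a) - v) ^ 4 ∂P ≤ C * ξ * (ω + v) := by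
  obtain ⟨C₄, hC₄, h4⟩ := exists_integral_gFun_pow_four_le hM0
  set V := M ^ 2 * Real.exp M with hV
  have hVpos : 0 < V := by positivity
  set C₂ := 3 * Real.exp (2 * M) + (4 * M * Real.exp (2 * M) + Real.exp (2 * M) * V) with hC₂
  have hC₂pos : 0 < C₂ := by positivity
  refine ⟨C₂ + V + 8 * (C₄ + V ^ 3), by positivity,
    fun lam a c ξ hl hM ha haξ hξ hc P ω v hP hω hv => ?_⟩
  have ha1 : a ≤ 1 := haξ.trans hξ
  have hc' : |c| ≤ 1 := hc.trans hξ
  have hξ0 : 0 < ξ := ha.trans_le haξ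
  obtain ⟨hc1, hc2⟩ := abs_le.1 hc'
  have hω0 : 0 ≤ ω := hω ▸ cosh_sub_one_nonneg _
  have hv0 : 0 ≤ v := hv ▸ cosh_sub_one_nonneg _
  have hPp : IsProbabilityMeasure P := by rw [hP]; infer_instance
  -- the mean is small
  have hvle : v ≤ V * ξ := by
    have hy : |lam * a * c| ≤ M * ξ := by
      rw [abs_mul, abs_of_pos (by positivity : 0 < lam * a)]
      calc lam * a * |c| ≤ M * 1 * ξ := by gcongr
        _ = _ := by ring
    have hy1 : |lam * a * c| ≤ M := hy.trans (by nlinarith)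
    calc v ≤ (lam * a * c) ^ 2 * Real.exp |lam * a * c| / 2 := hv ▸ cosh_sub_one_le _
      _ ≤ (M * ξ) ^ 2 * Real.exp M / 2 := by
          rw [← sq_abs]; gcongr
      _ ≤ (M * ξ) ^ 2 * Real.exp M := half_le_self (by positivity)
      _ = V * (ξ * ξ) := by rw [hV]; ring
      _ ≤ V * ξ := by gcongr; nlinarith
  have hvV : v ≤ V := hvle.trans (by nlinarith)
  have hmean : ∫ m, gFun m lam (lam * a) ∂P = v := by rw [hP, integral_gFun hl a hc1, hv]
  have hb0 : 0 ≤ lam * a ^ 2 := by positivity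
  have hbM : lam * a ^ 2 ≤ M * ξ := by
    calc lam * a ^ 2 = lam * (a * a) := by ring
      _ ≤ M * (ξ * 1) := by gcongr
      _ = _ := by ring
  have hbM1 : lam * a ^ 2 ≤ M := hbM.trans (by nlinarith)
  have hsq : |∫ m, gFun m lam (lam * a) ^ 2 ∂P - ω| ≤ C₂ * ξ * (ω + v) := by
    rw [hP, integral_gFun_sq hl a hc1, ← hv]
    set B := lam * a ^ 2 * (1 + c) with hB
    have hB0 : 0 ≤ B := mul_nonneg hb0 (by linarith)
    have hB2 : B ≤ 2 * (M * ξ) := by rw [hB]; nlinarith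
    have hB2' : B ≤ 2 * M := by nlinarith
    have heB : Real.exp B ≤ Real.exp (2 * M) := Real.exp_le_exp.2 hB2'
    have heB0 : 0 ≤ Real.exp B - 1 := by linarith [Real.one_le_exp hB0]
    have hdiff : |Real.cosh B - 1 - ω| ≤ 3 * Real.exp (2 * M) * ξ * ω := by
      rw [hω, show Real.cosh B - 1 - (Real.cosh (lam * a ^ 2) - 1) =
        Real.cosh B - Real.cosh (lam * a ^ 2) by ring]
      refine (abs_cosh_mul_one_add_sub_le hb0 hc').trans ?_
      rw [← hω]
      gcongr
    have t1 : (Real.exp B - 1) ≤ 2 * M * Real.exp (2 * M) * ξ := by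
      calc _ ≤ B * Real.exp B := exp_sub_one_le_mul_exp _
        _ ≤ 2 * (M * ξ) * Real.exp (2 * M) := by gcongr
        _ = _ := by ring
    have t2 : 2 * (Real.exp B - 1) * v + Real.exp B * v ^ 2 ≤
        (4 * M * Real.exp (2 * M) + Real.exp (2 * M) * V) * ξ * v := by
      calc _ = (2 * (Real.exp B - 1) + Real.exp B * v) * v := by ring
        _ ≤ (2 * (2 * M * Real.exp (2 * M) * ξ) + Real.exp (2 * M) * (V * ξ)) * v := by gcongr
        _ = _ := by ring
    have t3 : 0 ≤ 2 * (Real.exp B - 1) * v + Real.exp B * v ^ 2 := by positivity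
    calc |Real.cosh B - 1 + 2 * (Real.exp B - 1) * v + Real.exp B * v ^ 2 - ω|
        = |(Real.cosh B - 1 - ω) + (2 * (Real.exp B - 1) * v + Real.exp B * v ^ 2)| := by
          ring_nf
      _ ≤ |Real.cosh B - 1 - ω| + |2 * (Real.exp B - 1) * v + Real.exp B * v ^ 2| :=
          abs_add_le _ _
      _ ≤ 3 * Real.exp (2 * M) * ξ * ω +
          (4 * M * Real.exp (2 * M) + Real.exp (2 * M) * V) * ξ * v := by
          rw [abs_of_nonneg t3]; exact add_le_add hdiff t2
      _ ≤ C₂ * ξ * ω + C₂ * ξ * v := by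
          gcongr
          · rw [hC₂]; exact le_add_of_nonneg_right (by positivity)
          · rw [hC₂]; exact le_add_of_nonneg_left (by positivity)
      _ = _ := by ring
  have i1 : Integrable (fun m => gFun m lam (lam * a)) P := hP ▸ integrable_gFun _ hl ha ha1
  have ik : ∀ k, Integrable (fun m => gFun m lam (lam * a) ^ k) P :=
    fun k => hP ▸ integrable_gFun_pow _ hl ha ha1 k
  have hfour : ∫ m, gFun m lam (lam * a) ^ 4 ∂P ≤ C₄ * ξ * ω := by
    rw [hP, hω]
    exact (h4 lam a c hl hM ha ha1 hc').trans
      (by gcongr; exact cosh_sub_one_nonneg _)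
  have hs : 0 ≤ ξ * (ω + v) := by positivity
  have hv2 : v ^ 2 ≤ V * (ξ * (ω + v)) := by
    calc v ^ 2 = v * v := sq v
      _ ≤ V * ξ * v := by gcongr
      _ ≤ V * ξ * (ω + v) := by gcongr; linarith
      _ = _ := by ring
  refine ⟨hsq.trans ?_, ?_, hfour.trans ?_, ?_⟩
  · rw [mul_assoc, mul_assoc]
    refine mul_le_mul_of_nonneg_right ?_ hs
    have : 0 < V + 8 * (C₄ + V ^ 3) := by positivity
    linarith
  · have hvar : ∫ m, (gFun m lam (lam * a) - v) ^ 2 ∂P =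
        ∫ m, gFun m lam (lam * a) ^ 2 ∂P - v ^ 2 := by
      have : ∀ m, (gFun m lam (lam * a) - v) ^ 2 =
          gFun m lam (lam * a) ^ 2 - (2 * v * gFun m lam (lam * a) - v ^ 2) := fun m => by ring
      have i5 : Integrable (fun m => 2 * v * gFun m lam (lam * a) - v ^ 2) P :=
        (i1.const_mul _).sub (integrable_const _)
      simp_rw [this]
      rw [integral_sub (ik 2) i5,
        integral_sub (i1.const_mul _) (integrable_const _), integral_const_mul, hmean]
      simp only [integral_const, probReal_univ, smul_eq_mul]
      ring
    rw [hvar, show ∫ m, gFun m lam (lam * a) ^ 2 ∂P - v ^ 2 - ω =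
      (∫ m, gFun m lam (lam * a) ^ 2 ∂P - ω) - v ^ 2 by ring]
    refine (abs_sub _ _).trans ?_
    rw [abs_of_nonneg (sq_nonneg v)]
    have : 0 ≤ 8 * (C₄ + V ^ 3) * (ξ * (ω + v)) := by positivity
    nlinarith
  · have e : C₄ * ξ * ω ≤ C₄ * (ξ * (ω + v)) := by
      rw [mul_assoc]; gcongr; linarith
    refine e.trans ?_
    rw [mul_assoc]
    refine mul_le_mul_of_nonneg_right ?_ hs
    have : 0 < C₂ + V + 7 * C₄ + 8 * V ^ 3 := by positivity
    linarith
  · have hp : ∀ m, (gFun m lam (lam * a) - v) ^ 4 ≤ 8 * (gFun m lam (lam * a) ^ 4 + v ^ 4) := by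
      intro m
      have hx := (Even.add_pow_le (by decide : Even 4) :
        (gFun m lam (lam * a) + (-v)) ^ 4 ≤ 2 ^ (4 - 1) * (gFun m lam (lam * a) ^ 4 + (-v) ^ 4))
      rw [Even.neg_pow (by decide : Even 4), ← sub_eq_add_neg] at hx
      norm_num at hx
      exact hx
    have i4 : Integrable (fun m => (gFun m lam (lam * a) - v) ^ 4) P := by
      refine (((ik 4).fun_add (integrable_const (v ^ 4))).const_mul 8).mono' (by fun_prop)
        (Filter.Eventually.of_forall fun m => ?_)
      rw [Real.norm_of_nonneg (by positivity)]
      exact hp m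
    have h1 : ∫ m, (gFun m lam (lam * a) - v) ^ 4 ∂P ≤ 8 * (C₄ * ξ * ω + v ^ 4) := by
      refine (integral_mono i4
        (((ik 4).fun_add (integrable_const (v ^ 4))).const_mul 8) hp).trans ?_
      rw [integral_const_mul, integral_add (ik 4) (integrable_const _)]
      simp only [integral_const, probReal_univ, smul_eq_mul, one_mul]
      gcongr
    have hv4 : v ^ 4 ≤ V ^ 3 * (ξ * (ω + v)) := by
      calc v ^ 4 = v ^ 2 * v ^ 2 := by ring
        _ ≤ V ^ 2 * (V * (ξ * (ω + v))) := by gcongr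
        _ = _ := by ring
    have e : C₄ * ξ * ω ≤ C₄ * (ξ * (ω + v)) := by
      rw [mul_assoc]; gcongr; linarith
    have : 0 ≤ (C₂ + V) * (ξ * (ω + v)) := by positivity
    calc _ ≤ _ := h1
      _ ≤ 8 * (C₄ * (ξ * (ω + v)) + V ^ 3 * (ξ * (ω + v))) := by gcongr
      _ ≤ (C₂ + V) * (ξ * (ω + v)) + 8 * (C₄ * (ξ * (ω + v)) + V ^ 3 * (ξ * (ω + v))) := by
          linarith
      _ = _ := by ring

/-! ### The standard normal distribution function -/

lemma stdNormalCDF_eq (x : ℝ) : stdNormalCDF x = (gaussianReal 0 1).real (Set.Iic x) := by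
  rw [stdNormalCDF, cdf_eq_real]

lemma stdNormalCDF_mono : Monotone stdNormalCDF := fun _ _ h => monotone_cdf _ h

lemma stdNormalCDF_nonneg (x : ℝ) : 0 ≤ stdNormalCDF x := cdf_nonneg _ _

lemma stdNormalCDF_neg (x : ℝ) : stdNormalCDF (-x) = 1 - stdNormalCDF x := by
  have hmap : (gaussianReal 0 1).map (fun y => -y) = gaussianReal 0 1 := by
    simpa using gaussianReal_map_neg (μ := 0) (v := 1)
  have h1 : (gaussianReal 0 1).real (Set.Iic (-x)) = (gaussianReal 0 1).real (Set.Ici x) := by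
    conv_lhs => rw [← hmap]
    rw [map_measureReal_apply (by fun_prop) measurableSet_Iic]
    congr 1
    ext y; simp
  have : NullSingletonClass (gaussianReal 0 1) :=
    nullSingletonClass_gaussianReal (by norm_num)
  rw [stdNormalCDF_eq, stdNormalCDF_eq, h1, ← probReal_compl_eq_one_sub measurableSet_Iic,
    Set.compl_Iic]
  exact measureReal_congr Ioi_ae_eq_Ici.symm

lemma stdNormalCDF_sub_le {x y : ℝ} (h : x ≤ y) : stdNormalCDF y - stdNormalCDF x ≤ y - x := by
  have hpdf : ∀ z, gaussianPDF 0 1 z ≤ 1 := by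
    intro z
    rw [gaussianPDF, ← ENNReal.ofReal_one]
    refine ENNReal.ofReal_le_ofReal ?_
    rw [gaussianPDFReal]
    have h1 : (1 : ℝ) ≤ √(2 * Real.pi * (1 : NNReal)) := by
      rw [Real.one_le_sqrt, NNReal.coe_one]
      nlinarith [Real.pi_gt_three]
    have h2 : Real.exp (-(z - 0) ^ 2 / (2 * (1 : NNReal))) ≤ 1 := by
      rw [Real.exp_le_one_iff, NNReal.coe_one]
      nlinarith [sq_nonneg (z - 0)]
    exact mul_le_one₀ (inv_le_one_of_one_le₀ h1) (Real.exp_pos _).le h2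
  have hIoc : (gaussianReal 0 1) (Set.Ioc x y) ≤ ENNReal.ofReal (y - x) := by
    rw [gaussianReal_apply _ (by norm_num)]
    calc ∫⁻ z in Set.Ioc x y, gaussianPDF 0 1 z ≤ ∫⁻ _ in Set.Ioc x y, 1 :=
          lintegral_mono hpdf
      _ = _ := by simp
  rw [stdNormalCDF_eq, stdNormalCDF_eq, ← Set.Iic_union_Ioc_eq_Iic h,
    measureReal_union (Set.Iic_disjoint_Ioc le_rfl) measurableSet_Ioc, add_sub_cancel_left]
  exact ENNReal.toReal_le_of_le_ofReal (by linarith) hIoc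

lemma stdNormalCDF_zero : stdNormalCDF 0 = 1 / 2 := by
  have := stdNormalCDF_neg 0
  rw [neg_zero] at this; linarith

/-! ### A central limit theorem for triangular arrays -/

lemma norm_exp_mul_I_sub_le (y : ℝ) :
    ‖Complex.exp (y * Complex.I) - (1 + y * Complex.I - (y : ℂ) ^ 2 / 2)‖ ≤ 4 * |y| ^ 3 := by
  have hn : ‖(y : ℂ) * Complex.I‖ = |y| := by simp
  rcases le_or_gt |y| 1 with h | h
  · have h1 := Complex.exp_bound (x := y * Complex.I) (hn.le.trans h) (n := 3) (by norm_num)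
    rw [hn] at h1
    have e : ∑ m ∈ Finset.range 3, ((y : ℂ) * Complex.I) ^ m / (m.factorial : ℂ) =
        1 + y * Complex.I - (y : ℂ) ^ 2 / 2 := by
      simp [Finset.sum_range_succ, mul_pow, Nat.factorial]; ring
    rw [e] at h1
    refine h1.trans ?_
    have : 0 ≤ |y| ^ 3 := by positivity
    norm_num [Nat.factorial]
    nlinarith
  · have h1 : ‖Complex.exp (y * Complex.I)‖ = 1 := Complex.norm_exp_ofReal_mul_I y
    have h2 : ‖1 + (y : ℂ) * Complex.I - (y : ℂ) ^ 2 / 2‖ ≤ 1 + |y| + |y| ^ 2 / 2 := by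
      refine (norm_sub_le _ _).trans (add_le_add ((norm_add_le _ _).trans ?_) ?_)
      · rw [hn]; simp
      · simp
    have h3 : |y| ≤ |y| ^ 3 := le_self_pow₀ h.le (by norm_num)
    have h4 : |y| ^ 2 ≤ |y| ^ 3 := pow_le_pow_right₀ h.le (by norm_num)
    refine (norm_sub_le _ _).trans ?_
    rw [h1]; linarith

lemma abs_pow_three_le {κ : ℝ} (hκ : 0 < κ) (y : ℝ) :
    4 * |y| ^ 3 ≤ 2 * (κ * y ^ 2 + y ^ 4 / κ) := by
  have h : 2 * (κ * y ^ 2 + y ^ 4 / κ) - 4 * |y| ^ 3 = 2 * (|y| ^ 2 / κ) * (κ - |y|) ^ 2 := by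
    have e4 : y ^ 4 = |y| ^ 4 := (Even.pow_abs (by decide) y).symm
    rw [e4, ← sq_abs y]
    field_simp
    ring
  have : 0 ≤ 2 * (|y| ^ 2 / κ) * (κ - |y|) ^ 2 := by positivity
  linarith

lemma abs_exp_neg_sub_le {y : ℝ} (hy : 0 ≤ y) : |Real.exp (-y) - (1 - y)| ≤ y ^ 2 := by
  have h1 := Real.add_one_le_exp (-y)
  have h2 := Real.add_one_le_exp y
  have h3 : Real.exp y * Real.exp (-y) = 1 := by rw [← Real.exp_add]; simp
  rw [abs_le]
  constructor
  · nlinarith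
  · have h4 : (1 + y) * Real.exp (-y) ≤ 1 := by nlinarith [Real.exp_pos (-y)]
    have h5 : (1 + y) * (Real.exp (-y) - (1 - y + y ^ 2)) ≤ 0 := by
      nlinarith [pow_nonneg hy 3]
    have := nonpos_of_mul_nonpos_right h5 (by linarith)
    linarith

lemma norm_prod_sub_prod_le {ι : Type*} (s : Finset ι) (f g : ι → ℂ)
    (hf : ∀ i ∈ s, ‖f i‖ ≤ 1) (hg : ∀ i ∈ s, ‖g i‖ ≤ 1) :
    ‖∏ i ∈ s, f i - ∏ i ∈ s, g i‖ ≤ ∑ i ∈ s, ‖f i - g i‖ := by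
  classical
  induction s using Finset.induction with
  | empty => simp
  | insert i s hi ih =>
    rw [Finset.prod_insert hi, Finset.prod_insert hi, Finset.sum_insert hi]
    have ih' := ih (fun j hj => hf j (Finset.mem_insert_of_mem hj))
      (fun j hj => hg j (Finset.mem_insert_of_mem hj))
    have hp : ‖∏ j ∈ s, f j‖ ≤ 1 := by
      rw [norm_prod]
      exact Finset.prod_le_one (fun _ _ => norm_nonneg _)
        (fun j hj => hf j (Finset.mem_insert_of_mem hj))
    have hgi := hg i (Finset.mem_insert_self i s)
    calc ‖f i * ∏ j ∈ s, f j - g i * ∏ j ∈ s, g j‖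
        = ‖(f i - g i) * ∏ j ∈ s, f j + g i * (∏ j ∈ s, f j - ∏ j ∈ s, g j)‖ := by ring_nf
      _ ≤ ‖f i - g i‖ * ‖∏ j ∈ s, f j‖ + ‖g i‖ * ‖∏ j ∈ s, f j - ∏ j ∈ s, g j‖ := by
          refine (norm_add_le _ _).trans_eq ?_
          rw [norm_mul, norm_mul]
      _ ≤ ‖f i - g i‖ * 1 + 1 * ‖∏ j ∈ s, f j - ∏ j ∈ s, g j‖ := by gcongr
      _ ≤ _ := by rw [mul_one, one_mul]; gcongr

lemma sq_integral_sq_le {P : Measure ℕ} [IsProbabilityMeasure P] {X : ℕ → ℝ}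
    (h2 : Integrable (fun m => X m ^ 2) P) (h4 : Integrable (fun m => X m ^ 4) P) :
    (∫ m, X m ^ 2 ∂P) ^ 2 ≤ ∫ m, X m ^ 4 ∂P := by
  set s := ∫ m, X m ^ 2 ∂P
  have h : 0 ≤ ∫ m, (X m ^ 2 - s) ^ 2 ∂P := integral_nonneg fun m => sq_nonneg _
  have e : ∀ m, (X m ^ 2 - s) ^ 2 = X m ^ 4 - (2 * s * X m ^ 2 - s ^ 2) := fun m => by ring
  have i5 : Integrable (fun m => 2 * s * X m ^ 2 - s ^ 2) P :=
    (h2.const_mul _).sub (integrable_const _)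
  simp_rw [e] at h
  rw [integral_sub h4 i5, integral_sub (h2.const_mul _) (integrable_const _),
    integral_const_mul] at h
  simp only [integral_const, probReal_univ, smul_eq_mul] at h
  nlinarith

/-- Comparison of the characteristic function of a centred random variable with the Gaussian one
of the same variance; the parameter `κ` interpolates the third moment between the second and the
fourth. -/
lemma norm_integral_exp_sub_le {P : Measure ℕ} [IsProbabilityMeasure P] {X : ℕ → ℝ}
    (h1 : Integrable X P) (h2 : Integrable (fun m => X m ^ 2) P)
    (h4 : Integrable (fun m => X m ^ 4) P) (h0 : ∫ m, X m ∂P = 0) (t : ℝ) {κ : ℝ} (hκ : 0 < κ) :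
    ‖∫ m, Complex.exp (t * X m * Complex.I) ∂P -
        Complex.exp (-(t ^ 2 * ∫ m, X m ^ 2 ∂P) / 2 : ℝ)‖ ≤
      2 * κ * t ^ 2 * ∫ m, X m ^ 2 ∂P + (2 / κ + 1) * t ^ 4 * ∫ m, X m ^ 4 ∂P := by
  set s := ∫ m, X m ^ 2 ∂P with hs
  set q := ∫ m, X m ^ 4 ∂P with hq
  have hs0 : 0 ≤ s := integral_nonneg fun m => sq_nonneg _
  have hsq : s ^ 2 ≤ q := sq_integral_sq_le h2 h4
  have ie : Integrable (fun m => Complex.exp (t * X m * Complex.I)) P := by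
    refine (integrable_const (1 : ℝ)).mono' (by fun_prop) (Filter.Eventually.of_forall fun m => ?_)
    have := Complex.norm_exp_ofReal_mul_I (t * X m)
    push_cast at this
    exact this.le
  have iX : Integrable (fun m => ((t * X m : ℝ) : ℂ) * Complex.I) P :=
    ((h1.const_mul t).ofReal).mul_const _
  have iX2 : Integrable (fun m => ((t * X m : ℝ) : ℂ) ^ 2 / 2) P := by
    have := ((h2.const_mul (t ^ 2)).ofReal (𝕜 := ℂ)).div_const 2
    refine this.congr (Filter.Eventually.of_forall fun m => ?_)
    simp; ring
  have iT : Integrable (fun m => 1 + ((t * X m : ℝ) : ℂ) * Complex.I) P :=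
    (integrable_const 1).add iX
  have iT2 : Integrable (fun m => 1 + ((t * X m : ℝ) : ℂ) * Complex.I -
      ((t * X m : ℝ) : ℂ) ^ 2 / 2) P := iT.sub iX2
  have hT : ∫ m, (1 + ((t * X m : ℝ) : ℂ) * Complex.I - ((t * X m : ℝ) : ℂ) ^ 2 / 2) ∂P =
      ((1 - t ^ 2 * s / 2 : ℝ) : ℂ) := by
    rw [integral_sub iT iX2, integral_add (integrable_const _) iX, integral_mul_const,
      integral_complex_ofReal, integral_const_mul, h0, integral_div]
    have : ∫ m, ((t * X m : ℝ) : ℂ) ^ 2 ∂P = ((t ^ 2 * s : ℝ) : ℂ) := by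
      rw [hs, ← integral_const_mul, ← integral_complex_ofReal]
      refine integral_congr_ae (Filter.Eventually.of_forall fun m => ?_)
      simp; ring
    rw [this]; simp
  have hA : ‖∫ m, Complex.exp (t * X m * Complex.I) ∂P - ((1 - t ^ 2 * s / 2 : ℝ) : ℂ)‖ ≤
      2 * κ * t ^ 2 * s + 2 / κ * t ^ 4 * q := by
    rw [← hT, ← integral_sub ie iT2]
    have ib : Integrable (fun m => 2 * κ * t ^ 2 * X m ^ 2 + 2 / κ * t ^ 4 * X m ^ 4) P :=
      (h2.const_mul _).add (h4.const_mul _)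
    refine (norm_integral_le_of_norm_le ib (Filter.Eventually.of_forall fun m => ?_)).trans_eq ?_
    · have := (norm_exp_mul_I_sub_le (t * X m)).trans (abs_pow_three_le hκ (t * X m))
      rw [Complex.ofReal_mul] at this ⊢
      refine this.trans_eq ?_
      field_simp
    · rw [integral_add (h2.const_mul _) (h4.const_mul _), integral_const_mul, integral_const_mul]
  have hB : ‖((1 - t ^ 2 * s / 2 : ℝ) : ℂ) - Complex.exp (-(t ^ 2 * s) / 2 : ℝ)‖ ≤
      t ^ 4 * q := by
    rw [← Complex.ofReal_exp, ← Complex.ofReal_sub, Complex.norm_real, Real.norm_eq_abs,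
      abs_sub_comm, neg_div]
    refine (abs_exp_neg_sub_le (by positivity)).trans ?_
    have : t ^ 4 * s ^ 2 ≤ t ^ 4 * q := by gcongr
    have h0 : 0 ≤ t ^ 4 * s ^ 2 := by positivity
    nlinarith
  calc _ ≤ _ := norm_sub_le_norm_sub_add_norm_sub _ ((1 - t ^ 2 * s / 2 : ℝ) : ℂ) _
    _ ≤ _ := add_le_add hA hB
    _ = _ := by ring

lemma charFun_map_sum {N : ℕ} (P : Fin N → Measure ℕ) [∀ i, IsProbabilityMeasure (P i)]
    (X : Fin N → ℕ → ℝ) (t : ℝ) :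
    charFun ((Measure.pi P).map fun o => ∑ i, X i (o i)) t =
      ∏ i, ∫ m, Complex.exp (t * X i m * Complex.I) ∂P i := by
  rw [charFun_apply_real, integral_map (Measurable.aemeasurable .of_discrete) (by fun_prop),
    ← integral_fintype_prod_eq_prod (fun i m => Complex.exp (t * X i m * Complex.I))]
  refine integral_congr_ae (Filter.Eventually.of_forall fun o => ?_)
  simp only
  rw [← Complex.exp_sum]
  push_cast
  rw [Finset.mul_sum, Finset.sum_mul]

lemma norm_charFun_sum_sub_le {N : ℕ} (P : Fin N → Measure ℕ) [∀ i, IsProbabilityMeasure (P i)]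
    (X : Fin N → ℕ → ℝ) (h1 : ∀ i, Integrable (X i) (P i))
    (h2 : ∀ i, Integrable (fun m => X i m ^ 2) (P i))
    (h4 : ∀ i, Integrable (fun m => X i m ^ 4) (P i)) (h0 : ∀ i, ∫ m, X i m ∂P i = 0)
    {τ : ℝ} (hτ : 0 < τ) (hs : |∑ i, ∫ m, X i m ^ 2 ∂P i - 1| ≤ τ)
    (hq : ∑ i, ∫ m, X i m ^ 4 ∂P i ≤ τ) (t : ℝ) :
    ‖charFun ((Measure.pi P).map fun o => ∑ i, X i (o i)) t - charFun (gaussianReal 0 1) t‖ ≤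
      2 * √τ * t ^ 2 * (1 + τ) + (2 * √τ + τ) * t ^ 4 + t ^ 2 * τ := by
  set S := ∑ i, ∫ m, X i m ^ 2 ∂P i with hS
  have hS0 : 0 ≤ S := Finset.sum_nonneg fun i _ => integral_nonneg fun m => sq_nonneg _
  have hκ : 0 < √τ := Real.sqrt_pos.2 hτ
  have hA : ‖charFun ((Measure.pi P).map fun o => ∑ i, X i (o i)) t -
      Complex.exp (-(t ^ 2 * S) / 2 : ℝ)‖ ≤
      2 * √τ * t ^ 2 * (1 + τ) + (2 * √τ + τ) * t ^ 4 := by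
    have e : Complex.exp (-(t ^ 2 * S) / 2 : ℝ) =
        ∏ i, Complex.exp (-(t ^ 2 * ∫ m, X i m ^ 2 ∂P i) / 2 : ℝ) := by
      rw [← Complex.exp_sum, ← Complex.ofReal_sum, ← Finset.sum_div, Finset.sum_neg_distrib,
        ← Finset.mul_sum]
    rw [charFun_map_sum, e]
    refine (norm_prod_sub_prod_le _ _ _ (fun i _ => ?_) (fun i _ => ?_)).trans ?_
    · refine (norm_integral_le_of_norm_le (integrable_const (1 : ℝ))
        (Filter.Eventually.of_forall fun m => ?_)).trans_eq (by simp)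
      have := Complex.norm_exp_ofReal_mul_I (t * X i m)
      push_cast at this
      exact this.le
    · rw [← Complex.ofReal_exp, Complex.norm_real, Real.norm_eq_abs, Real.abs_exp,
        Real.exp_le_one_iff, neg_div, neg_nonpos]
      have : 0 ≤ ∫ m, X i m ^ 2 ∂P i := integral_nonneg fun m => sq_nonneg _
      positivity
    · refine (Finset.sum_le_sum fun i _ =>
        norm_integral_exp_sub_le (h1 i) (h2 i) (h4 i) (h0 i) t hκ).trans ?_
      rw [Finset.sum_add_distrib, ← Finset.mul_sum, ← Finset.mul_sum, ← hS]
      have h3 : S ≤ 1 + τ := by linarith [(abs_le.1 hs).2]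
      have e2 : (2 * √τ + τ) * t ^ 4 = (2 / √τ + 1) * t ^ 4 * τ := by
        have := Real.mul_self_sqrt hτ.le
        have h5 : 2 * √τ = 2 / √τ * τ := by
          rw [div_mul_eq_mul_div, eq_div_iff hκ.ne']; nlinarith
        rw [h5]; ring
      rw [e2]
      gcongr
  have hB : ‖(Complex.exp (-(t ^ 2 * S) / 2 : ℝ)) - charFun (gaussianReal 0 1) t‖ ≤ t ^ 2 * τ := by
    have e : charFun (gaussianReal 0 1) t = ((Real.exp (-(t ^ 2) / 2) : ℝ) : ℂ) := by
      rw [charFun_gaussianReal]; push_cast; congr 1; simp; ring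
    rw [e, ← Complex.ofReal_exp, ← Complex.ofReal_sub, Complex.norm_real, Real.norm_eq_abs]
    have key : ∀ x y : ℝ, x ≤ y → y ≤ 0 → |Real.exp x - Real.exp y| ≤ y - x := by
      intro x y hxy hy
      have h1 := Real.exp_le_exp.2 hxy
      have h2 := Real.add_one_le_exp (x - y)
      have h3 : Real.exp x = Real.exp y * Real.exp (x - y) := by rw [← Real.exp_add]; ring_nf
      have h4 : Real.exp y ≤ 1 := Real.exp_le_one_iff.2 hy
      rw [abs_of_nonpos (by linarith), h3]
      nlinarith [Real.exp_pos y]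
    have ht : 0 ≤ t ^ 2 := sq_nonneg t
    obtain ⟨l1, l2⟩ := abs_le.1 hs
    rcases le_total 1 S with h | h
    · refine (key _ _ (by nlinarith) (by linarith)).trans ?_
      nlinarith
    · rw [abs_sub_comm]
      refine (key _ _ (by nlinarith) (by nlinarith)).trans ?_
      nlinarith
  exact (norm_sub_le_norm_sub_add_norm_sub _ _ _).trans (add_le_add hA hB)

/-- **Central limit theorem, uniform version**: a sum of independent centred random variables with
total variance near `1` and small total fourth moment is nearly standard normal. The proof is by
compactness: a sequence of counterexamples converges weakly to the normal law by Lévy's theorem. -/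
lemma exists_normal_approx (R : ℝ) {ε : ℝ} (hε : 0 < ε) : ∃ τ : ℝ, 0 < τ ∧
    ∀ (N : ℕ) (P : Fin N → Measure ℕ) (X : Fin N → ℕ → ℝ), (∀ i, IsProbabilityMeasure (P i)) →
      (∀ i, Integrable (X i) (P i)) → (∀ i, Integrable (fun m => X i m ^ 2) (P i)) →
      (∀ i, Integrable (fun m => X i m ^ 4) (P i)) → (∀ i, ∫ m, X i m ∂P i = 0) →
      |∑ i, ∫ m, X i m ^ 2 ∂P i - 1| ≤ τ → ∑ i, ∫ m, X i m ^ 4 ∂P i ≤ τ →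
      ∀ x, |x| ≤ R →
        |(Measure.pi P).real {o | ∑ i, X i (o i) ≤ x} - stdNormalCDF x| ≤ ε := by
  by_contra hcon
  push Not at hcon
  choose N P X hP h1 h2 h4 h0 hs hq x hx hbad using
    fun k : ℕ => hcon (1 / ((k : ℝ) + 1)) (by positivity)
  have hmeas : ∀ k, Measurable (fun o : Fin (N k) → ℕ => ∑ i, X k i (o i)) := fun k => by fun_prop
  let ν : ℕ → ProbabilityMeasure ℝ := fun k =>
    ⟨(Measure.pi (P k)).map fun o => ∑ i, X k i (o i),
      Measure.isProbabilityMeasure_map (hmeas k).aemeasurable⟩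
  let γ : ProbabilityMeasure ℝ := ⟨gaussianReal 0 1, inferInstance⟩
  have hτ : Filter.Tendsto (fun k : ℕ => 1 / ((k : ℝ) + 1)) Filter.atTop (nhds 0) :=
    tendsto_one_div_add_atTop_nhds_zero_nat
  have hν : Filter.Tendsto ν Filter.atTop (nhds γ) := by
    refine ProbabilityMeasure.tendsto_of_tendsto_charFun fun t => ?_
    rw [tendsto_iff_norm_sub_tendsto_zero]
    have hlim : Filter.Tendsto (fun k : ℕ => 2 * √(1 / ((k : ℝ) + 1)) * t ^ 2 *
        (1 + 1 / ((k : ℝ) + 1)) + (2 * √(1 / ((k : ℝ) + 1)) + 1 / ((k : ℝ) + 1)) * t ^ 4 +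
        t ^ 2 * (1 / ((k : ℝ) + 1))) Filter.atTop (nhds 0) := by
      have hc : Continuous (fun τ : ℝ => 2 * √τ * t ^ 2 * (1 + τ) + (2 * √τ + τ) * t ^ 4 +
        t ^ 2 * τ) := by fun_prop
      have := (hc.tendsto 0).comp hτ
      simpa [Function.comp_def] using this
    refine squeeze_zero (fun _ => norm_nonneg _) (fun k => ?_) hlim
    have := hP k
    exact norm_charFun_sum_sub_le (P k) (X k) (h1 k) (h2 k) (h4 k) (h0 k) (by positivity)
      (hs k) (hq k) t
  have hna : NullSingletonClass (gaussianReal 0 1) :=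
    nullSingletonClass_gaussianReal (by norm_num)
  have hcdf : ∀ y, Filter.Tendsto (fun k => (ν k : Measure ℝ).real (Set.Iic y)) Filter.atTop
      (nhds (stdNormalCDF y)) := by
    intro y
    have h := ProbabilityMeasure.tendsto_measure_of_null_frontier_of_tendsto' hν (E := Set.Iic y)
      (by rw [frontier_Iic]; exact hna.measure_singleton y)
    rw [stdNormalCDF_eq]
    exact (ENNReal.tendsto_toReal (measure_ne_top _ _)).comp h
  obtain ⟨y, -, φ, hφ, hy⟩ := tendsto_subseq_of_bounded (Metric.isBounded_closedBall
    (x := (0 : ℝ)) (r := R)) (x := x) (fun k => by simpa [Metric.mem_closedBall, dist_zero_right] using hx k)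
  have hν' : ∀ k, (Measure.pi (P k)).real {o | ∑ i, X k i (o i) ≤ x k} =
      (ν k : Measure ℝ).real (Set.Iic (x k)) := fun k => by
    change _ = ((Measure.pi (P k)).map fun o => ∑ i, X k i (o i)).real _
    rw [map_measureReal_apply (hmeas k) measurableSet_Iic]
    rfl
  have hball := hy.eventually (Metric.ball_mem_nhds y (by positivity : 0 < ε / 8))
  have hup := ((hcdf (y + ε / 8)).comp hφ.tendsto_atTop).eventually
    (Metric.ball_mem_nhds _ (by positivity : 0 < ε / 4))
  have hlo := ((hcdf (y - ε / 8)).comp hφ.tendsto_atTop).eventually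
    (Metric.ball_mem_nhds _ (by positivity : 0 < ε / 4))
  obtain ⟨k, hb, hu, hl⟩ := (hball.and (hup.and hlo)).exists
  refine (hbad (φ k)).not_ge ?_
  rw [hν']
  simp only [Function.comp_apply, Real.dist_eq] at hb hu hl
  rw [abs_lt] at hb hu hl
  have m1 : (ν (φ k) : Measure ℝ).real (Set.Iic (x (φ k))) ≤
      (ν (φ k) : Measure ℝ).real (Set.Iic (y + ε / 8)) :=
    measureReal_mono (Set.Iic_subset_Iic.2 (by linarith))
  have m2 : (ν (φ k) : Measure ℝ).real (Set.Iic (y - ε / 8)) ≤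
      (ν (φ k) : Measure ℝ).real (Set.Iic (x (φ k))) :=
    measureReal_mono (Set.Iic_subset_Iic.2 (by linarith))
  have n1 := stdNormalCDF_sub_le (show x (φ k) ≤ y + ε / 8 by linarith)
  have n2 := stdNormalCDF_sub_le (show y - ε / 8 ≤ x (φ k) by linarith)
  rw [abs_le]
  constructor <;> linarith

/-! ### Likelihood ratios and the Bayes risk of the sign prior -/

/-- The law of independent Poisson counts with rates `lam (1 + c_i)`, `i < N`: the relative
parametrization of `dataLaw`, in which `c = 0` is the null. -/
def relLaw (lam : ℝ) {N : ℕ} (c : Fin N → ℝ) : Measure (Fin N → ℕ) :=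
  Measure.pi fun i => poissonMeasure (Real.toNNReal (lam * (1 + c i)))

instance (lam : ℝ) {N : ℕ} (c : Fin N → ℝ) : IsProbabilityMeasure (relLaw lam c) := by
  unfold relLaw; infer_instance

lemma dataLaw_eq_relLaw (n : ℝ) {N : ℕ} (hN : 1 ≤ N) (Q : Fin N → ℝ) :
    dataLaw n Q = relLaw (n / N) (fun i => N * Q i - 1) := by
  have hN0 : (N : ℝ) ≠ 0 := by positivity
  unfold dataLaw relLaw
  congr 1
  funext i
  congr 2
  field_simp
  ring

lemma dataLaw_unifRate (n : ℝ) {N : ℕ} (hN : 1 ≤ N) :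
    dataLaw n (unifRate N) = relLaw (n / N) (fun _ : Fin N => 0) := by
  have hN0 : (N : ℝ) ≠ 0 := by positivity
  rw [dataLaw_eq_relLaw n hN]
  congr 1
  funext i
  simp [unifRate, hN0]

lemma one_add_hFun_nonneg {lam : ℝ} (hl : 0 < lam) {c : ℝ} (hc : -1 ≤ c) (m : ℕ) :
    0 ≤ 1 + hFun m lam (lam * c) := by
  rw [hFun_mul hl.ne']
  have h1 : 0 ≤ 1 + c := by linarith
  have : 0 ≤ Real.exp (-(lam * c)) * (1 + c) ^ m := by positivity
  linarith

lemma poissonMeasure_toNNReal_singleton {r : ℝ} (hr : 0 ≤ r) (m : ℕ) :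
    poissonMeasure (Real.toNNReal r) {m} = ENNReal.ofReal (poisMass r m) := by
  rw [poissonMeasure_singleton, Real.coe_toNNReal _ hr]
  rfl

lemma relLaw_eq_withDensity {lam : ℝ} (hl : 0 < lam) {N : ℕ} {c : Fin N → ℝ}
    (hc : ∀ i, -1 ≤ c i) :
    relLaw lam c = (relLaw lam (fun _ : Fin N => 0)).withDensity
      (fun o => ENNReal.ofReal (∏ i, (1 + hFun (o i) lam (lam * c i)))) := by
  refine Measure.ext_of_singleton fun o => ?_
  rw [withDensity_apply _ (measurableSet_singleton o), lintegral_singleton]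
  unfold relLaw
  rw [Measure.pi_singleton, Measure.pi_singleton,
    ENNReal.ofReal_prod_of_nonneg (fun i _ => one_add_hFun_nonneg hl (hc i) _),
    ← Finset.prod_mul_distrib]
  refine Finset.prod_congr rfl fun i _ => ?_
  rw [poissonMeasure_toNNReal_singleton (mul_nonneg hl.le (by linarith [hc i])), add_zero,
    mul_one, poissonMeasure_toNNReal_singleton hl.le, ← ENNReal.ofReal_mul
      (one_add_hFun_nonneg hl (hc i) _), ← poisMass_mul_one_add_hFun hl.ne', mul_comm]

lemma integrable_one_add_hFun (r : NNReal) {lam : ℝ} (hl : 0 < lam) (c : ℝ) :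
    Integrable (fun m => 1 + hFun m lam (lam * c)) (poissonMeasure r) := by
  simp_rw [hFun_mul hl.ne']
  exact (integrable_const 1).add
    (((integrable_pow_poisson r _).const_mul _).sub (integrable_const 1))

lemma integrable_likelihood {lam : ℝ} (hl : 0 < lam) {N : ℕ} (c : Fin N → ℝ) :
    Integrable (fun o : Fin N → ℕ => ∏ i, (1 + hFun (o i) lam (lam * c i)))
      (relLaw lam (fun _ : Fin N => 0)) :=
  Integrable.fintype_prod (f := fun i m => 1 + hFun m lam (lam * c i))
    fun i => integrable_one_add_hFun _ hl (c i)

lemma integrable_ite {N : ℕ} {μ : Measure (Fin N → ℕ)} [IsProbabilityMeasure μ]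
    {f : (Fin N → ℕ) → ℝ} (hf : Integrable f μ) (ψ : (Fin N → ℕ) → Bool) :
    Integrable (fun o => if ψ o = true then 1 else f o) μ := by
  refine ((integrable_const (1 : ℝ)).add hf.norm).mono' (Measurable.aestronglyMeasurable
    .of_discrete) (Filter.Eventually.of_forall fun o => ?_)
  simp only [Pi.add_apply]
  split_ifs
  · simp
  · simp

/-- The sum of the two error probabilities as one integral under the null. -/
lemma errors_eq_integral {lam : ℝ} (hl : 0 < lam) {N : ℕ} {c : Fin N → ℝ}
    (hc : ∀ i, -1 ≤ c i) (ψ : (Fin N → ℕ) → Bool) :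
    (relLaw lam (fun _ : Fin N => 0)).real {o | ψ o = true} +
        (relLaw lam c).real {o | ψ o = false} =
      ∫ o, (if ψ o = true then 1 else ∏ i, (1 + hFun (o i) lam (lam * c i)))
        ∂relLaw lam (fun _ : Fin N => 0) := by
  set μ := relLaw lam (fun _ : Fin N => 0) with hμ
  have hS : MeasurableSet {o : Fin N → ℕ | ψ o = true} := .of_discrete
  have hcompl : {o : Fin N → ℕ | ψ o = true}ᶜ = {o | ψ o = false} := by ext o; simp
  rw [← integral_add_compl hS (integrable_ite (integrable_likelihood hl c) ψ), hcompl]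
  congr 1
  · have e : Set.EqOn (fun o => if ψ o = true then (1 : ℝ) else
        ∏ i, (1 + hFun (o i) lam (lam * c i))) (fun _ => 1) {o | ψ o = true} :=
      fun o ho => if_pos ho
    rw [setIntegral_congr_fun hS e]
    simp [hμ]
  · have hS' : MeasurableSet {o : Fin N → ℕ | ψ o = false} := .of_discrete
    have e : Set.EqOn (fun o => if ψ o = true then (1 : ℝ) else
        ∏ i, (1 + hFun (o i) lam (lam * c i)))
        (fun o => ∏ i, (1 + hFun (o i) lam (lam * c i))) {o | ψ o = false} :=
      fun o ho => if_neg (by simp [show ψ o = false from ho])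
    rw [setIntegral_congr_fun hS' e,
      integral_eq_lintegral_of_nonneg_ae
        (Filter.Eventually.of_forall fun o => Finset.prod_nonneg fun i _ =>
          one_add_hFun_nonneg hl (hc i) _) (Measurable.aestronglyMeasurable .of_discrete),
      measureReal_def, relLaw_eq_withDensity hl hc, withDensity_apply _ hS']

/-- The relative perturbation attached to a vector of signs. -/
def signPert (a : ℝ) {N : ℕ} (s : Fin N → Bool) (i : Fin N) : ℝ := if s i = true then a else -a

lemma abs_signPert {a : ℝ} (ha : 0 ≤ a) {N : ℕ} (s : Fin N → Bool) (i : Fin N) :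
    |signPert a s i| = a := by
  unfold signPert; split_ifs <;> simp [abs_of_nonneg ha]

/-- The likelihood ratio of the symmetric sign prior is the product of the factors `1 + g`. -/
lemma sum_likelihood_signPert (lam a : ℝ) {N : ℕ} (o : Fin N → ℕ) :
    ∑ s : Fin N → Bool, ∏ i, (1 + hFun (o i) lam (lam * signPert a s i)) =
      2 ^ N * ∏ i, (1 + gFun (o i) lam (lam * a)) := by
  have h := Finset.prod_univ_sum (t := fun _ : Fin N => (Finset.univ : Finset Bool))
    (f := fun i b => 1 + hFun (o i) lam (lam * (if b = true then a else -a)))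
  rw [Fintype.piFinset_univ] at h
  unfold signPert
  rw [← h]
  have h2 : (2 : ℝ) ^ N = ∏ _i : Fin N, (2 : ℝ) := by simp
  rw [h2, ← Finset.prod_mul_distrib]
  refine Finset.prod_congr rfl fun i _ => ?_
  rw [Fintype.sum_bool]
  simp [gFun]
  ring

lemma integrable_mixture {lam a : ℝ} (hl : 0 < lam) (ha : 0 < a) (ha1 : a ≤ 1) {N : ℕ} :
    Integrable (fun o : Fin N → ℕ => ∏ i, (1 + gFun (o i) lam (lam * a)))
      (relLaw lam (fun _ : Fin N => 0)) :=
  Integrable.fintype_prod (f := fun _ m => 1 + gFun m lam (lam * a))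
    fun _ => (integrable_const 1).add (integrable_gFun _ hl ha ha1)

/-- The error probabilities averaged over the sign prior. -/
lemma sum_errors_signPert {lam a : ℝ} (hl : 0 < lam) (ha : 0 < a) (ha1 : a ≤ 1) {N : ℕ}
    (ψ : (Fin N → ℕ) → Bool) :
    ∑ s : Fin N → Bool, ((relLaw lam (fun _ : Fin N => 0)).real {o | ψ o = true} +
        (relLaw lam (signPert a s)).real {o | ψ o = false}) =
      2 ^ N * ∫ o, (if ψ o = true then 1 else ∏ i, (1 + gFun (o i) lam (lam * a)))
        ∂relLaw lam (fun _ : Fin N => 0) := by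
  have hc : ∀ (s : Fin N → Bool) i, -1 ≤ signPert a s i := fun s i => by
    have := abs_signPert ha.le s i
    linarith [neg_abs_le (signPert a s i)]
  simp_rw [fun s => errors_eq_integral hl (hc s) ψ]
  rw [← integral_finsetSum _ fun s _ => integrable_ite (integrable_likelihood hl _) ψ,
    ← integral_const_mul]
  refine integral_congr_ae (Filter.Eventually.of_forall fun o => ?_)
  simp only
  split_ifs with h
  · simp
  · exact sum_likelihood_signPert lam a o

/-- Neyman–Pearson: the test that rejects when the mixture likelihood ratio is at least `1` has
the smallest average risk over the sign prior. -/
lemma sum_errors_likelihoodTest_le {lam a : ℝ} (hl : 0 < lam) (ha : 0 < a) (ha1 : a ≤ 1) {N : ℕ}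
    (ψ φ : (Fin N → ℕ) → Bool)
    (hφ : ∀ o, φ o = true ↔ 1 ≤ ∏ i, (1 + gFun (o i) lam (lam * a))) :
    ∑ s : Fin N → Bool, ((relLaw lam (fun _ : Fin N => 0)).real {o | φ o = true} +
        (relLaw lam (signPert a s)).real {o | φ o = false}) ≤
      ∑ s : Fin N → Bool, ((relLaw lam (fun _ : Fin N => 0)).real {o | ψ o = true} +
        (relLaw lam (signPert a s)).real {o | ψ o = false}) := by
  rw [sum_errors_signPert hl ha ha1, sum_errors_signPert hl ha ha1]
  refine mul_le_mul_of_nonneg_left ?_ (by positivity)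
  refine integral_mono (integrable_ite (integrable_mixture hl ha ha1) _)
    (integrable_ite (integrable_mixture hl ha ha1) _) fun o => ?_
  have := hφ o
  simp only
  split_ifs with h1 h2 h2
  · exact le_rfl
  · exact this.1 h1
  · exact (not_le.1 fun h => h1 (this.2 h)).le
  · exact le_rfl

/-- The chi-square bound: no test beats random guessing by much if the second moment of the
mixture likelihood ratio is close to `1`. -/
lemma sum_errors_ge_of_small {lam a : ℝ} (hl : 0 < lam) (ha : 0 < a) (ha1 : a ≤ 1) {N : ℕ}
    (ψ : (Fin N → ℕ) → Bool) {t : ℝ} (ht : 0 < t) :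
    2 ^ N * (1 - (t + (Real.exp (N * (Real.cosh (lam * a ^ 2) - 1)) - 1) / t) / 2) ≤
      ∑ s : Fin N → Bool, ((relLaw lam (fun _ : Fin N => 0)).real {o | ψ o = true} +
        (relLaw lam (signPert a s)).real {o | ψ o = false}) := by
  rw [sum_errors_signPert hl ha ha1]
  refine mul_le_mul_of_nonneg_left ?_ (by positivity)
  set μ := relLaw lam (fun _ : Fin N => 0) with hμ
  set L : (Fin N → ℕ) → ℝ := fun o => ∏ i, (1 + gFun (o i) lam (lam * a)) with hL
  set ω := Real.cosh (lam * a ^ 2) - 1 with hω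
  have ig : ∀ r, Integrable (fun m => gFun m lam (lam * a)) (poissonMeasure r) :=
    fun r => integrable_gFun r hl ha ha1
  have ig2 : ∀ r, Integrable (fun m => gFun m lam (lam * a) ^ 2) (poissonMeasure r) :=
    fun r => integrable_gFun_pow r hl ha ha1 2
  have iL : Integrable L μ := integrable_mixture hl ha ha1
  have isq : ∀ r, Integrable (fun m => (1 + gFun m lam (lam * a)) ^ 2) (poissonMeasure r) := by
    intro r
    have : Integrable (fun m => 1 + 2 * gFun m lam (lam * a) + gFun m lam (lam * a) ^ 2)
        (poissonMeasure r) := ((integrable_const 1).add ((ig r).const_mul 2)).add (ig2 r)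
    refine this.congr (Filter.Eventually.of_forall fun m => ?_)
    simp only; ring
  have eL2 : ∀ o, L o ^ 2 = ∏ i, (1 + gFun (o i) lam (lam * a)) ^ 2 := fun o => by
    rw [hL, Finset.prod_pow]
  have iL2 : Integrable (fun o => L o ^ 2) μ := by
    simp_rw [eL2]
    exact Integrable.fintype_prod (f := fun _ m => (1 + gFun m lam (lam * a)) ^ 2) fun _ => isq _
  have hrate : Real.toNNReal (lam * (1 + 0)) = Real.toNNReal lam := by simp
  have h1 : ∫ o, L o ∂μ = 1 := by
    rw [hμ, relLaw, hrate, hL, integral_fintype_prod_eq_prod (fun _ m => 1 + gFun m lam (lam * a))]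
    refine Finset.prod_eq_one fun i _ => ?_
    rw [integral_add (integrable_const 1) (ig _), integral_gFun_null hl]
    simp
  have h2 : ∫ o, L o ^ 2 ∂μ ≤ Real.exp (N * ω) := by
    simp_rw [eL2]
    rw [hμ, relLaw, hrate,
      integral_fintype_prod_eq_prod (fun _ m => (1 + gFun m lam (lam * a)) ^ 2)]
    have : ∫ m, (1 + gFun m lam (lam * a)) ^ 2 ∂poissonMeasure (Real.toNNReal lam) = 1 + ω := by
      have e : ∀ m, (1 + gFun m lam (lam * a)) ^ 2 =
          (1 + 2 * gFun m lam (lam * a)) + gFun m lam (lam * a) ^ 2 := fun m => by ring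
      have i1 : Integrable (fun m => 1 + 2 * gFun m lam (lam * a))
        (poissonMeasure (Real.toNNReal lam)) := (integrable_const 1).add ((ig _).const_mul 2)
      simp_rw [e]
      rw [integral_add i1 (ig2 _), integral_add (integrable_const 1) ((ig _).const_mul 2),
        integral_const_mul, integral_gFun_null hl, integral_gFun_sq_null hl]
      simp [hω]
    rw [this, Finset.prod_const, Finset.card_univ, Fintype.card_fin, Real.exp_nat_mul]
    have hω0 : 0 ≤ ω := cosh_sub_one_nonneg _
    exact pow_le_pow_left₀ (by linarith) (by linarith [Real.add_one_le_exp ω]) N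
  -- `|L - 1| ≤ (t + (L - 1)² / t) / 2` avoids a Cauchy–Schwarz step
  have hpt : ∀ o, 1 - (t + (L o ^ 2 - 2 * L o + 1) / t) / 2 ≤
      (if ψ o = true then 1 else L o) := by
    intro o
    have e : (t + (L o ^ 2 - 2 * L o + 1) / t) / 2 - (1 - L o) = (t + L o - 1) ^ 2 / (2 * t) := by
      field_simp; ring
    have h0 : 0 ≤ (t + L o - 1) ^ 2 / (2 * t) := by positivity
    have h0' : 0 ≤ (t + (L o ^ 2 - 2 * L o + 1) / t) / 2 := by
      rw [show L o ^ 2 - 2 * L o + 1 = (L o - 1) ^ 2 by ring]; positivity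
    split_ifs <;> linarith
  have iq : Integrable (fun o => L o ^ 2 - 2 * L o + 1) μ :=
    (iL2.sub (iL.const_mul 2)).add (integrable_const 1)
  have il : Integrable (fun o => (t + (L o ^ 2 - 2 * L o + 1) / t) / 2) μ :=
    ((integrable_const t).add (iq.div_const t)).div_const 2
  have il' : Integrable (fun o => 1 - (t + (L o ^ 2 - 2 * L o + 1) / t) / 2) μ :=
    (integrable_const 1).sub il
  refine le_trans ?_ (integral_mono il' (integrable_ite iL ψ) hpt)
  have e : ∫ o, (1 - (t + (L o ^ 2 - 2 * L o + 1) / t) / 2) ∂μ =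
      1 - (t + (∫ o, L o ^ 2 ∂μ - 1) / t) / 2 := by
    rw [integral_sub (integrable_const 1) il, integral_div,
      integral_add (integrable_const t) (iq.div_const t), integral_div]
    have i3 : Integrable (fun o => L o ^ 2 - 2 * L o) μ := iL2.sub (iL.const_mul 2)
    rw [integral_add i3 (integrable_const 1), integral_sub iL2 (iL.const_mul 2),
      integral_const_mul, h1]
    simp
    ring
  rw [e]
  gcongr

/-! ### The score statistic -/

/-- The score statistic `∑ i, g(o_i)`, the linear histogram statistic with weights `g`. -/
def scoreSum (lam a : ℝ) {N : ℕ} (o : Fin N → ℕ) : ℝ := ∑ i, gFun (o i) lam (lam * a)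

/-- The mean of the score statistic at the relative perturbation `c`. -/
def scoreMean (lam a : ℝ) {N : ℕ} (c : Fin N → ℝ) : ℝ := ∑ i, (Real.cosh (lam * a * c i) - 1)

/-- The variance `u²` of the score statistic under the null. -/
def nullVar (lam a : ℝ) (N : ℕ) : ℝ := N * (Real.cosh (lam * a ^ 2) - 1)

lemma scoreMean_nonneg (lam a : ℝ) {N : ℕ} (c : Fin N → ℝ) : 0 ≤ scoreMean lam a c :=
  Finset.sum_nonneg fun _ _ => cosh_sub_one_nonneg _

lemma nullVar_nonneg (lam a : ℝ) (N : ℕ) : 0 ≤ nullVar lam a N :=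
  mul_nonneg (Nat.cast_nonneg N) (cosh_sub_one_nonneg _)

lemma scoreMean_zero (lam a : ℝ) {N : ℕ} : scoreMean lam a (fun _ : Fin N => 0) = 0 := by
  simp [scoreMean]

lemma scoreMean_signPert (lam a : ℝ) {N : ℕ} (s : Fin N → Bool) :
    scoreMean lam a (signPert a s) = nullVar lam a N := by
  unfold scoreMean nullVar
  have : ∀ i, Real.cosh (lam * a * signPert a s i) = Real.cosh (lam * a ^ 2) := by
    intro i
    unfold signPert
    split_ifs
    · ring_nf
    · rw [mul_neg, Real.cosh_neg]; ring_nf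
  simp [this]
  ring

lemma exists_sum_moment_bounds {M : ℝ} (hM0 : 0 < M) :
    ∃ C : ℝ, 0 < C ∧ ∀ (N : ℕ) (lam a ξ : ℝ) (c : Fin N → ℝ), 0 < lam → lam ≤ M → 0 < a →
      a ≤ ξ → ξ ≤ 1 → (∀ i, |c i| ≤ ξ) →
      ∀ P : Fin N → Measure ℕ, (∀ i, P i = poissonMeasure (Real.toNNReal (lam * (1 + c i)))) →
      |∑ i, ∫ m, gFun m lam (lam * a) ^ 2 ∂P i - nullVar lam a N| ≤
        C * ξ * (nullVar lam a N + scoreMean lam a c) ∧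
      |∑ i, ∫ m, (gFun m lam (lam * a) - (Real.cosh (lam * a * c i) - 1)) ^ 2 ∂P i -
        nullVar lam a N| ≤ C * ξ * (nullVar lam a N + scoreMean lam a c) ∧
      ∑ i, ∫ m, gFun m lam (lam * a) ^ 4 ∂P i ≤
        C * ξ * (nullVar lam a N + scoreMean lam a c) ∧
      ∑ i, ∫ m, (gFun m lam (lam * a) - (Real.cosh (lam * a * c i) - 1)) ^ 4 ∂P i ≤
        C * ξ * (nullVar lam a N + scoreMean lam a c) := by
  obtain ⟨C, hC, h⟩ := exists_moment_bounds hM0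
  refine ⟨C, hC, fun N lam a ξ c hl hM ha haξ hξ hc P hP => ?_⟩
  have hi := fun i => h lam a (c i) ξ hl hM ha haξ hξ (hc i) (P i) _ _ (hP i) rfl rfl
  have hnv : nullVar lam a N = ∑ _i : Fin N, (Real.cosh (lam * a ^ 2) - 1) := by
    simp [nullVar]; ring
  have hsum : C * ξ * (nullVar lam a N + scoreMean lam a c) =
      ∑ i, C * ξ * ((Real.cosh (lam * a ^ 2) - 1) + (Real.cosh (lam * a * c i) - 1)) := by
    rw [← Finset.mul_sum, Finset.sum_add_distrib, hnv, scoreMean]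
  rw [hsum]
  refine ⟨?_, ?_, Finset.sum_le_sum fun i _ => (hi i).2.2.1,
    Finset.sum_le_sum fun i _ => (hi i).2.2.2⟩
  · rw [hnv, ← Finset.sum_sub_distrib]
    exact (Finset.abs_sum_le_sum_abs _ _).trans (Finset.sum_le_sum fun i _ => (hi i).1)
  · rw [hnv, ← Finset.sum_sub_distrib]
    exact (Finset.abs_sum_le_sum_abs _ _).trans (Finset.sum_le_sum fun i _ => (hi i).2.1)

/-- Asymptotic normality of the score statistic, uniformly over the alternatives whose mean stays
bounded and over bounded arguments `y`, as long as `u` stays away from `0`. -/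
lemma exists_scoreSum_normal_approx {M k K ε : ℝ} (hM0 : 0 < M) (hk : 0 < k) (hε : 0 < ε) :
    ∃ ξ₀ : ℝ, 0 < ξ₀ ∧ ξ₀ ≤ 1 ∧ ∀ (N : ℕ) (lam a ξ : ℝ) (c : Fin N → ℝ), 0 < lam → lam ≤ M →
      0 < a → a ≤ ξ → ξ ≤ ξ₀ → (∀ i, |c i| ≤ ξ) → k ≤ √(nullVar lam a N) →
      scoreMean lam a c ≤ K → ∀ y, |y| ≤ K →
      |(relLaw lam c).real {o | scoreSum lam a o ≤ y} -
        stdNormalCDF ((y - scoreMean lam a c) / √(nullVar lam a N))| ≤ ε := by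
  obtain ⟨C, hC, hmom⟩ := exists_sum_moment_bounds hM0
  obtain ⟨τ, hτ, hclt⟩ := exists_normal_approx (2 * |K| / k) hε
  set A := C * (1 + |K| / k ^ 2) with hA
  set B := C * (1 / k ^ 2 + |K| / k ^ 4) with hB
  have hApos : 0 < A := by positivity
  have hBpos : 0 < B := by positivity
  refine ⟨min 1 (min (τ / A) (τ / B)), by positivity, min_le_left _ _,
    fun N lam a ξ c hl hM ha haξ hξ hc hku hmK y hy => ?_⟩
  have hξ1 : ξ ≤ 1 := hξ.trans (min_le_left _ _)
  have hξA : A * ξ ≤ τ := by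
    have := hξ.trans ((min_le_right _ _).trans (min_le_left _ _))
    rwa [le_div_iff₀ hApos, mul_comm] at this
  have hξB : B * ξ ≤ τ := by
    have := hξ.trans ((min_le_right _ _).trans (min_le_right _ _))
    rwa [le_div_iff₀ hBpos, mul_comm] at this
  have hξ0 : 0 < ξ := ha.trans_le haξ
  set u := √(nullVar lam a N) with hu
  have hu0 : 0 < u := hk.trans_le hku
  have hu2 : u ^ 2 = nullVar lam a N := Real.sq_sqrt (nullVar_nonneg _ _ _)
  set μ := scoreMean lam a c with hμ
  have hμ0 : 0 ≤ μ := scoreMean_nonneg _ _ _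
  have hμK : μ ≤ |K| := hmK.trans (le_abs_self K)
  have hk2 : k ^ 2 ≤ u ^ 2 := pow_le_pow_left₀ hk.le hku 2
  set P : Fin N → Measure ℕ := fun i => poissonMeasure (Real.toNNReal (lam * (1 + c i))) with hP
  obtain ⟨-, hm2, -, hm4⟩ := hmom N lam a ξ c hl hM ha haξ hξ1 hc P fun i => rfl
  rw [← hu2, ← hμ] at hm2 hm4
  set v : Fin N → ℝ := fun i => Real.cosh (lam * a * c i) - 1 with hv
  set X : Fin N → ℕ → ℝ := fun i m => (gFun m lam (lam * a) - v i) / u with hX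
  have hc1 : ∀ i, -1 ≤ c i := fun i => by linarith [neg_abs_le (c i), hc i]
  have ha1 : a ≤ 1 := haξ.trans hξ1
  have ig : ∀ i, Integrable (fun m => gFun m lam (lam * a)) (P i) :=
    fun i => integrable_gFun _ hl ha ha1
  -- every power of the centred score is dominated by a geometric sequence
  have ipow : ∀ (i : Fin N) (j : ℕ), Integrable (fun m => X i m ^ j) (P i) := by
    intro i j
    refine integrable_poisson_of_le_pow _ (A := ((Real.exp lam + 1 + |v i|) / u) ^ j)
      (s := 2 ^ j) fun m => ?_
    rw [abs_pow, ← pow_mul, mul_comm j m, pow_mul, ← mul_pow]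
    refine pow_le_pow_left₀ (abs_nonneg _) ?_ j
    rw [hX, abs_div, abs_of_pos hu0, div_mul_eq_mul_div]
    have h1 := abs_gFun_le hl ha ha1 m
    have h2 : (1 : ℝ) ≤ 2 ^ m := one_le_pow₀ (by norm_num)
    have h3 := abs_sub (gFun m lam (lam * a)) (v i)
    have h4 : |v i| ≤ |v i| * 2 ^ m := le_mul_of_one_le_right (abs_nonneg _) h2
    gcongr
    linarith
  have e2 : ∑ i, ∫ m, X i m ^ 2 ∂P i =
      (∑ i, ∫ m, (gFun m lam (lam * a) - v i) ^ 2 ∂P i) / u ^ 2 := by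
    rw [Finset.sum_div]
    refine Finset.sum_congr rfl fun i _ => ?_
    rw [← integral_div]
    simp_rw [hX, div_pow]
  have e4 : ∑ i, ∫ m, X i m ^ 4 ∂P i =
      (∑ i, ∫ m, (gFun m lam (lam * a) - v i) ^ 4 ∂P i) / u ^ 4 := by
    rw [Finset.sum_div]
    refine Finset.sum_congr rfl fun i _ => ?_
    rw [← integral_div]
    simp_rw [hX, div_pow]
  have hratio : μ / u ^ 2 ≤ |K| / k ^ 2 := by gcongr
  have key := hclt N P X (fun i => by rw [hP]; infer_instance)
    (fun i => by simpa using ipow i 1) (fun i => ipow i 2) (fun i => ipow i 4)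
    (fun i => by
      rw [hX]
      simp only
      rw [integral_div, integral_sub (ig i) (integrable_const _), hP]
      simp only
      rw [integral_gFun hl a (hc1 i)]
      simp [hv])
    (by
      rw [e2, div_sub_one (by positivity), abs_div, abs_of_pos (by positivity : 0 < u ^ 2),
        div_le_iff₀ (by positivity)]
      refine hm2.trans ?_
      calc C * ξ * (u ^ 2 + μ) = C * (1 + μ / u ^ 2) * ξ * u ^ 2 := by field_simp
        _ ≤ C * (1 + |K| / k ^ 2) * ξ * u ^ 2 := by gcongr
        _ ≤ τ * u ^ 2 := by gcongr)
    (by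
      rw [e4, div_le_iff₀ (by positivity)]
      refine hm4.trans ?_
      have h4 : k ^ 4 ≤ u ^ 4 := pow_le_pow_left₀ hk.le hku 4
      calc C * ξ * (u ^ 2 + μ) = C * (1 / u ^ 2 + μ / u ^ 4) * ξ * u ^ 4 := by field_simp
        _ ≤ C * (1 / k ^ 2 + |K| / k ^ 4) * ξ * u ^ 4 := by gcongr
        _ ≤ τ * u ^ 4 := by gcongr)
    ((y - μ) / u)
    (by
      rw [abs_div, abs_of_pos hu0]
      have h1 : |y - μ| ≤ 2 * |K| := by
        refine (abs_sub _ _).trans ?_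
        rw [abs_of_nonneg hμ0]
        linarith [hy.trans (le_abs_self K)]
      gcongr)
  have hset : {o : Fin N → ℕ | ∑ i, X i (o i) ≤ (y - μ) / u} = {o | scoreSum lam a o ≤ y} := by
    ext o
    have : ∑ i, X i (o i) = (scoreSum lam a o - μ) / u := by
      rw [hX, ← Finset.sum_div, Finset.sum_sub_distrib]
      rfl
    simp only [Set.mem_ofPred_eq]
    rw [this, div_le_div_iff_of_pos_right hu0, sub_le_sub_iff_right]
  rw [hset] at key
  exact key

/-! ### Chebyshev bounds -/

lemma chebyshev_pi {N : ℕ} (P : Fin N → Measure ℕ) [∀ i, IsProbabilityMeasure (P i)] {F : ℕ → ℝ}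
    (h2 : ∀ i, Integrable (fun m => F m ^ 2) (P i)) {t : ℝ} (ht : 0 < t) :
    (Measure.pi P).real {o | t ≤ |∑ i, F (o i) - ∑ i, ∫ m, F m ∂P i|} ≤
      (∑ i, ∫ m, (F m - ∫ k, F k ∂P i) ^ 2 ∂P i) / t ^ 2 := by
  have hL : ∀ i, MemLp F 2 (P i) := fun i =>
    (memLp_two_iff_integrable_sq (by fun_prop)).2 (h2 i)
  have h1 : ∀ i, Integrable F (P i) := fun i => (hL i).integrable (by norm_num)
  set S : (Fin N → ℕ) → ℝ := ∑ i, fun o => F (o i) with hS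
  have hSo : ∀ o, S o = ∑ i, F (o i) := fun o => by rw [hS, Finset.sum_apply]
  have hSL : MemLp S 2 (Measure.pi P) :=
    memLp_finsetSum' _ fun i _ => (hL i).comp_measurePreserving (measurePreserving_eval P i)
  have hE : ∫ o, S o ∂Measure.pi P = ∑ i, ∫ m, F m ∂P i := by
    simp_rw [hSo]
    rw [integral_finsetSum _ fun i _ => integrable_comp_eval (h1 i)]
    exact Finset.sum_congr rfl fun i _ => integral_comp_eval (by fun_prop)
  have hV := variance_sum_pi (X := fun _ => F) hL
  have hv : ∀ i, Var[F; P i] = ∫ m, (F m - ∫ k, F k ∂P i) ^ 2 ∂P i := fun i =>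
    variance_eq_integral (by fun_prop)
  simp_rw [hv] at hV
  have key := meas_ge_le_variance_div_sq hSL ht
  rw [hE, show Var[S; Measure.pi P] = _ from hV] at key
  simp_rw [hSo] at key
  exact ENNReal.toReal_le_of_le_ofReal (div_nonneg (Finset.sum_nonneg fun i _ =>
    integral_nonneg fun m => sq_nonneg _) (sq_nonneg t)) key

lemma markov_pi {N : ℕ} (P : Fin N → Measure ℕ) [∀ i, IsProbabilityMeasure (P i)] {F : ℕ → ℝ}
    (h0 : ∀ m, 0 ≤ F m) (h1 : ∀ i, Integrable F (P i)) {t : ℝ} (ht : 0 < t) :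
    (Measure.pi P).real {o | t ≤ ∑ i, F (o i)} ≤ (∑ i, ∫ m, F m ∂P i) / t := by
  have hint : Integrable (fun o : Fin N → ℕ => ∑ i, F (o i)) (Measure.pi P) :=
    integrable_finsetSum _ fun i _ => integrable_comp_eval (h1 i)
  have key := mul_meas_ge_le_integral_of_nonneg
    (Filter.Eventually.of_forall fun o => Finset.sum_nonneg fun i _ => h0 (o i)) hint t
  rw [integral_finsetSum _ fun i _ => integrable_comp_eval (h1 i)] at key
  rw [le_div_iff₀ ht, mul_comm]
  refine key.trans_eq (Finset.sum_congr rfl fun i _ => integral_comp_eval (by fun_prop))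

/-- Chebyshev's inequality for the score statistic. -/
lemma exists_scoreSum_chebyshev {M : ℝ} (hM0 : 0 < M) :
    ∃ C : ℝ, 0 < C ∧ ∀ (N : ℕ) (lam a ξ : ℝ) (c : Fin N → ℝ), 0 < lam → lam ≤ M → 0 < a →
      a ≤ ξ → ξ ≤ 1 → (∀ i, |c i| ≤ ξ) → ∀ t, 0 < t →
      (relLaw lam c).real {o | t ≤ |scoreSum lam a o - scoreMean lam a c|} ≤
        C * (nullVar lam a N + scoreMean lam a c) / t ^ 2 := by
  obtain ⟨C, hC, hmom⟩ := exists_sum_moment_bounds hM0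
  refine ⟨1 + C, by positivity, fun N lam a ξ c hl hM ha haξ hξ hc t ht => ?_⟩
  have hc1 : ∀ i, -1 ≤ c i := fun i => by linarith [neg_abs_le (c i), hc i]
  have hξ0 : 0 < ξ := ha.trans_le haξ
  obtain ⟨-, hm2, -, -⟩ := hmom N lam a ξ c hl hM ha haξ hξ hc _ fun i => rfl
  have key := chebyshev_pi (fun i => poissonMeasure (Real.toNNReal (lam * (1 + c i))))
    (F := fun m => gFun m lam (lam * a))
    (fun i => integrable_gFun_pow _ hl ha (haξ.trans hξ) 2) ht
  simp_rw [fun i => integral_gFun hl a (hc1 i)] at key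
  refine key.trans ?_
  have hn := nullVar_nonneg lam a N
  have hs := scoreMean_nonneg lam a c
  have h2 := (abs_le.1 hm2).2
  have h3 : C * ξ * (nullVar lam a N + scoreMean lam a c) ≤
      C * 1 * (nullVar lam a N + scoreMean lam a c) := by gcongr
  gcongr
  linarith

/-! ### Expansion of the log-likelihood ratio -/

lemma abs_log_one_add_sub_le {x κ : ℝ} (hκ : κ ≤ 1 / 2) (hx : |x| ≤ κ) :
    |Real.log (1 + x) - x + x ^ 2 / 2| ≤ 2 * κ * x ^ 2 := by
  have hx1 : |-x| < 1 := by rw [abs_neg]; linarith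
  have h := Real.abs_log_sub_add_sum_range_le hx1 2
  rw [abs_neg] at h
  norm_num [Finset.sum_range_succ] at h
  have e : Real.log (1 + x) - x + x ^ 2 / 2 = -x + x ^ 2 / 2 + Real.log (1 + x) := by ring
  rw [e]
  refine h.trans ?_
  rw [div_le_iff₀ (by linarith), pow_succ, sq_abs]
  have h0 : 0 ≤ |x| := abs_nonneg x
  have hκ0 : 0 ≤ κ := h0.trans hx
  have h1 : x ^ 2 * |x| ≤ x ^ 2 * κ := by gcongr
  have h2 : 0 ≤ x ^ 2 * κ * (1 - 2 * |x|) := by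
    have : 0 ≤ 1 - 2 * |x| := by linarith
    positivity
  nlinarith

/-- With high probability, under the null and under every alternative of bounded mean score, the
mixture likelihood ratio is `exp (T - u² / 2)` up to a factor near `1`, where `T` is the score. -/
lemma exists_log_likelihood_approx {M K θ ε : ℝ} (hM0 : 0 < M) (hK : 0 < K) (hθ : 0 < θ)
    (hε : 0 < ε) :
    ∃ ξ₀ : ℝ, 0 < ξ₀ ∧ ξ₀ ≤ 1 ∧ ∀ (N : ℕ) (lam a ξ : ℝ) (c : Fin N → ℝ), 0 < lam → lam ≤ M →
      0 < a → a ≤ ξ → ξ ≤ ξ₀ → (∀ i, |c i| ≤ ξ) → nullVar lam a N ≤ K →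
      scoreMean lam a c ≤ K →
      (relLaw lam c).real {o | ¬ (0 < ∏ i, (1 + gFun (o i) lam (lam * a)) ∧
        |Real.log (∏ i, (1 + gFun (o i) lam (lam * a))) -
          (scoreSum lam a o - nullVar lam a N / 2)| ≤ θ)} ≤ ε := by
  obtain ⟨C, hC, hmom⟩ := exists_sum_moment_bounds hM0
  set κ := min (1 / 2) (θ / (4 * (K + θ))) with hκ
  have hκ0 : 0 < κ := by positivity
  have hκ1 : κ ≤ 1 / 2 := min_le_left _ _
  have hκ2 : κ * (K + θ) ≤ θ / 4 := by
    have : κ ≤ θ / (4 * (K + θ)) := min_le_right _ _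
    calc κ * (K + θ) ≤ θ / (4 * (K + θ)) * (K + θ) := by gcongr
      _ = θ / 4 := by field_simp
  set A := C * (2 * K) with hA
  have hA0 : 0 < A := by positivity
  refine ⟨min 1 (min (ε / 2 * κ ^ 4 / A) (min (ε / 2 * (θ / 4) ^ 2 / A) (θ / 4 / A))),
    by positivity, min_le_left _ _, fun N lam a ξ c hl hM ha haξ hξ hc hnK hmK => ?_⟩
  have hξ1 : ξ ≤ 1 := hξ.trans (min_le_left _ _)
  have hξ' := hξ.trans (min_le_right _ _)
  have b1 : A * ξ ≤ ε / 2 * κ ^ 4 := by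
    have := hξ'.trans (min_le_left _ _)
    rwa [le_div_iff₀ hA0, mul_comm] at this
  have hξ'' := hξ'.trans (min_le_right _ _)
  have b2 : A * ξ ≤ ε / 2 * (θ / 4) ^ 2 := by
    have := hξ''.trans (min_le_left _ _)
    rwa [le_div_iff₀ hA0, mul_comm] at this
  have b3 : A * ξ ≤ θ / 4 := by
    have := hξ''.trans (min_le_right _ _)
    rwa [le_div_iff₀ hA0, mul_comm] at this
  have hξ0 : 0 < ξ := ha.trans_le haξ
  have ha1 : a ≤ 1 := haξ.trans hξ1
  set P : Fin N → Measure ℕ := fun i => poissonMeasure (Real.toNNReal (lam * (1 + c i))) with hP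
  obtain ⟨hm2, -, hm4, -⟩ := hmom N lam a ξ c hl hM ha haξ hξ1 hc P fun i => rfl
  have hbound : C * ξ * (nullVar lam a N + scoreMean lam a c) ≤ A * ξ := by
    rw [hA, mul_right_comm]
    gcongr
    linarith
  set g : ℕ → ℝ := fun m => gFun m lam (lam * a) with hg
  have ik : ∀ (j : ℕ) (i : Fin N), Integrable (fun m => g m ^ j) (P i) := fun j i =>
    integrable_gFun_pow _ hl ha ha1 j
  have k1 := markov_pi P (F := fun m => g m ^ 4) (fun m => by positivity) (ik 4)
    (pow_pos hκ0 4)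
  have k2 := chebyshev_pi P (F := fun m => g m ^ 2) (fun i => by
    simp_rw [← pow_mul]; exact ik 4 i) (by positivity : 0 < θ / 4)
  have k1' : (relLaw lam c).real {o | κ ^ 4 ≤ ∑ i, g (o i) ^ 4} ≤ ε / 2 := by
    refine k1.trans ?_
    rw [div_le_iff₀ (by positivity)]
    exact hm4.trans (hbound.trans b1)
  have k2' : (relLaw lam c).real {o | θ / 4 ≤ |∑ i, g (o i) ^ 2 - ∑ i, ∫ m, g m ^ 2 ∂P i|} ≤
      ε / 2 := by
    refine k2.trans ?_
    rw [div_le_iff₀ (by positivity)]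
    refine le_trans (Finset.sum_le_sum fun i _ => ?_) (hm4.trans (hbound.trans b2))
    -- the variance of `g²` is at most its second moment
    have hvar := variance_le_expectation_sq (μ := P i) (X := fun m => g m ^ 2) (by fun_prop)
    rw [variance_eq_integral (by fun_prop)] at hvar
    refine hvar.trans_eq (integral_congr_ae (Filter.Eventually.of_forall fun m => ?_))
    simp only [Pi.pow_apply, hg]; ring
  refine (measureReal_mono (s₂ := {o | κ ^ 4 ≤ ∑ i, g (o i) ^ 4} ∪
    {o | θ / 4 ≤ |∑ i, g (o i) ^ 2 - ∑ i, ∫ m, g m ^ 2 ∂P i|}) ?_).trans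
    ((measureReal_union_le _ _).trans (by linarith))
  intro o ho
  by_contra hcon
  rw [Set.mem_union, not_or] at hcon
  obtain ⟨g4, g2⟩ := hcon
  simp only [Set.mem_ofPred_eq, not_le] at g4 g2 ho
  refine ho ?_
  have hgi : ∀ i, |g (o i)| ≤ κ := by
    intro i
    have h1 : g (o i) ^ 4 ≤ ∑ j, g (o j) ^ 4 :=
      Finset.single_le_sum (f := fun j => g (o j) ^ 4) (fun j _ => by positivity)
        (Finset.mem_univ i)
    refine le_of_pow_le_pow_left₀ (by norm_num : 4 ≠ 0) hκ0.le ?_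
    rw [Even.pow_abs (by decide)]
    exact h1.trans g4.le
  have hpos : ∀ i, 0 < 1 + g (o i) := fun i => by
    have := (abs_le.1 (hgi i)).1
    linarith
  refine ⟨Finset.prod_pos fun i _ => hpos i, ?_⟩
  rw [Real.log_prod fun i _ => (hpos i).ne']
  set S := ∑ i, g (o i) ^ 2 with hS
  have hSn : |S - nullVar lam a N| ≤ θ / 2 := by
    have h1 := hm2.trans (hbound.trans b3)
    have := abs_sub_le S (∑ i, ∫ m, g m ^ 2 ∂P i) (nullVar lam a N)
    linarith
  have hSK : S ≤ K + θ := by linarith [(abs_le.1 hSn).2]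
  have hlog : |∑ i, Real.log (1 + g (o i)) - scoreSum lam a o + S / 2| ≤ 2 * κ * S := by
    have e : ∑ i, Real.log (1 + g (o i)) - scoreSum lam a o + S / 2 =
        ∑ i, (Real.log (1 + g (o i)) - g (o i) + g (o i) ^ 2 / 2) := by
      rw [Finset.sum_add_distrib, Finset.sum_sub_distrib, ← Finset.sum_div]
      rfl
    rw [e, hS, Finset.mul_sum]
    exact (Finset.abs_sum_le_sum_abs _ _).trans
      (Finset.sum_le_sum fun i _ => abs_log_one_add_sub_le hκ1 (hgi i))
  have hκS : 2 * κ * S ≤ θ / 2 := by nlinarith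
  rw [abs_le] at hlog hSn ⊢
  constructor <;> linarith

/-! ### The likelihood ratio test -/

/-- Both error probabilities of the likelihood ratio test against the sign prior are at least
`Φ(-u/2)` up to a small error. -/
lemma exists_likelihoodTest_errors_ge {M k K ε : ℝ} (hM0 : 0 < M) (hk : 0 < k) (hK : 0 < K)
    (hε : 0 < ε) :
    ∃ ξ₀ : ℝ, 0 < ξ₀ ∧ ξ₀ ≤ 1 ∧ ∀ (N : ℕ) (lam a ξ : ℝ) (s : Fin N → Bool), 0 < lam →
      lam ≤ M → 0 < a → a ≤ ξ → ξ ≤ ξ₀ → k ≤ √(nullVar lam a N) → √(nullVar lam a N) ≤ K →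
      ∀ φ : (Fin N → ℕ) → Bool,
        (∀ o, φ o = true ↔ 1 ≤ ∏ i, (1 + gFun (o i) lam (lam * a))) →
        2 * stdNormalCDF (-√(nullVar lam a N) / 2) - ε ≤
          (relLaw lam (fun _ : Fin N => 0)).real {o | φ o = true} +
            (relLaw lam (signPert a s)).real {o | φ o = false} := by
  -- the threshold shift `θ` costs `θ / u ≤ ε / 16` in each normal probability
  set θ := k * (ε / 16) with hθ
  have hθ0 : 0 < θ := by positivity
  obtain ⟨ξ₁, hξ₁, hξ₁1, hclt⟩ := exists_scoreSum_normal_approx (K := 2 * K ^ 2 + θ) hM0 hk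
    (by positivity : 0 < ε / 8)
  obtain ⟨ξ₂, hξ₂, hξ₂1, hlog⟩ := exists_log_likelihood_approx (K := K ^ 2) (θ := θ / 2) hM0
    (by positivity) (by positivity) (by positivity : 0 < ε / 8)
  refine ⟨min ξ₁ ξ₂, by positivity, (min_le_left _ _).trans hξ₁1,
    fun N lam a ξ s hl hM ha haξ hξ hku hKu φ hφ => ?_⟩
  have hξ0 : 0 < ξ := ha.trans_le haξ
  set u := √(nullVar lam a N) with hu
  have hu0 : 0 < u := hk.trans_le hku
  have hu2 : nullVar lam a N = u ^ 2 := (Real.sq_sqrt (nullVar_nonneg _ _ _)).symm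
  have huK : u ^ 2 ≤ K ^ 2 := pow_le_pow_left₀ hu0.le hKu 2
  have hθu : θ / u ≤ ε / 16 := by
    rw [div_le_iff₀ hu0, hθ, mul_comm]; gcongr
  have hs : ∀ i, |signPert a s i| ≤ ξ := fun i => (abs_signPert ha.le s i).le.trans haξ
  have h0 : ∀ i : Fin N, |(fun _ => (0 : ℝ)) i| ≤ ξ := fun i => by simpa using hξ0.le
  have c0 := hclt N lam a ξ _ hl hM ha haξ (hξ.trans (min_le_left _ _)) h0 hku
    (by rw [scoreMean_zero]; positivity) (u ^ 2 / 2 + θ)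
    (by rw [abs_of_nonneg (by positivity)]; nlinarith)
  have cs := hclt N lam a ξ _ hl hM ha haξ (hξ.trans (min_le_left _ _)) hs hku
    (by rw [scoreMean_signPert, hu2]; nlinarith) (u ^ 2 / 2 - θ)
    (by rw [abs_le]; constructor <;> nlinarith)
  have l0 := hlog N lam a ξ _ hl hM ha haξ (hξ.trans (min_le_right _ _)) h0 (hu2 ▸ huK)
    (by rw [scoreMean_zero]; positivity)
  have ls := hlog N lam a ξ _ hl hM ha haξ (hξ.trans (min_le_right _ _)) hs (hu2 ▸ huK)
    (by rw [scoreMean_signPert, hu2]; exact huK)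
  rw [scoreMean_zero, ← hu] at c0
  rw [scoreMean_signPert, ← hu, hu2] at cs
  rw [hu2] at l0 ls
  set bad : Set (Fin N → ℕ) := {o | ¬ (0 < ∏ i, (1 + gFun (o i) lam (lam * a)) ∧
        |Real.log (∏ i, (1 + gFun (o i) lam (lam * a))) -
          (scoreSum lam a o - u ^ 2 / 2)| ≤ θ / 2)} with hbad
  have e1 : 1 - (relLaw lam (fun _ : Fin N => 0)).real {o | scoreSum lam a o ≤ u ^ 2 / 2 + θ} ≤
      (relLaw lam (fun _ : Fin N => 0)).real {o | φ o = true} + ε / 8 := by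
    rw [← probReal_compl_eq_one_sub .of_discrete]
    refine (measureReal_mono (s₂ := {o | φ o = true} ∪ bad) fun o ho => ?_).trans
      ((measureReal_union_le _ _).trans (by linarith))
    by_contra hcon
    rw [Set.mem_union, not_or] at hcon
    obtain ⟨n1, n2⟩ := hcon
    simp only [hbad, Set.mem_compl_iff, Set.mem_ofPred_eq, not_le, not_not] at ho n1 n2
    refine n1 ((hφ o).2 ?_)
    rw [← Real.log_nonneg_iff n2.1]
    linarith [(abs_le.1 n2.2).1]
  have e2 : (relLaw lam (signPert a s)).real {o | scoreSum lam a o ≤ u ^ 2 / 2 - θ} ≤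
      (relLaw lam (signPert a s)).real {o | φ o = false} + ε / 8 := by
    refine (measureReal_mono (s₂ := {o | φ o = false} ∪ bad) fun o ho => ?_).trans
      ((measureReal_union_le _ _).trans (by linarith))
    by_contra hcon
    rw [Set.mem_union, not_or] at hcon
    obtain ⟨n1, n2⟩ := hcon
    simp only [hbad, Set.mem_ofPred_eq, not_not, Bool.not_eq_false] at ho n1 n2
    have h1 := Real.log_nonneg ((hφ o).1 n1)
    linarith [(abs_le.1 n2.2).2]
  have f1 : stdNormalCDF ((u ^ 2 / 2 + θ - 0) / u) ≤ stdNormalCDF (u / 2) + ε / 16 := by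
    have e : (u ^ 2 / 2 + θ - 0) / u = u / 2 + θ / u := by field_simp; ring
    have := stdNormalCDF_sub_le (show u / 2 ≤ u / 2 + θ / u from
      le_add_of_nonneg_right (by positivity))
    rw [e]; linarith
  have f2 : stdNormalCDF (-u / 2) - ε / 16 ≤ stdNormalCDF ((u ^ 2 / 2 - θ - u ^ 2) / u) := by
    have e : (u ^ 2 / 2 - θ - u ^ 2) / u = -u / 2 - θ / u := by field_simp; ring
    have := stdNormalCDF_sub_le (show -u / 2 - θ / u ≤ -u / 2 from
      sub_le_self _ (by positivity))
    rw [e]; linarith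
  have f3 : stdNormalCDF (-u / 2) = 1 - stdNormalCDF (u / 2) := by
    rw [neg_div, stdNormalCDF_neg]
  rw [abs_le] at c0 cs
  linarith

/-! ### Reduction to equal perturbations -/

/-- As a function of `s = t²`, `cosh (b t)` lies above its tangent line at `s = 1`, being a power
series in `s` with non-negative coefficients. -/
lemma exists_cosh_tangent (b : ℝ) :
    ∃ κ : ℝ, 0 ≤ κ ∧ ∀ t : ℝ, κ * (t ^ 2 - 1) ≤ Real.cosh (b * t) - Real.cosh b := by
  have hsum : Summable fun k : ℕ => (k : ℝ) * (b ^ (2 * k) / ((2 * k).factorial : ℝ)) := by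
    refine Summable.of_nonneg_of_le (fun k => ?_) (fun k => ?_)
      (Real.hasSum_cosh (2 * b)).summable
    · rw [pow_mul]; positivity
    · have h1 : (k : ℝ) ≤ 2 ^ (2 * k) := by
        have : k ≤ 2 ^ (2 * k) := (Nat.lt_two_pow_self).le.trans
          (Nat.pow_le_pow_right (by norm_num) (by omega))
        exact_mod_cast this
      have h2 : 0 ≤ b ^ (2 * k) / ((2 * k).factorial : ℝ) := by rw [pow_mul]; positivity
      calc _ ≤ 2 ^ (2 * k) * (b ^ (2 * k) / ((2 * k).factorial : ℝ)) := by gcongr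
        _ = _ := by rw [mul_pow]; ring
  refine ⟨∑' k : ℕ, (k : ℝ) * (b ^ (2 * k) / ((2 * k).factorial : ℝ)),
    tsum_nonneg fun k => by rw [pow_mul]; positivity, fun t => ?_⟩
  refine hasSum_le (fun k => ?_) (hsum.hasSum.mul_right (t ^ 2 - 1))
    ((Real.hasSum_cosh (b * t)).sub (Real.hasSum_cosh b))
  have hB := one_add_mul_le_pow (show (-2 : ℝ) ≤ t ^ 2 - 1 by nlinarith [sq_nonneg t]) k
  rw [add_sub_cancel, ← pow_mul] at hB
  have h2 : 0 ≤ b ^ (2 * k) / ((2 * k).factorial : ℝ) := by rw [pow_mul]; positivity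
  calc _ = b ^ (2 * k) / ((2 * k).factorial : ℝ) * (k * (t ^ 2 - 1)) := by ring
    _ ≤ b ^ (2 * k) / ((2 * k).factorial : ℝ) * (t ^ (2 * k) - 1) := by gcongr; linarith
    _ = _ := by rw [mul_pow]; ring

/-- For `p ≤ 2` the mean `cosh (lam a c) - 1` is a convex function of `|c| ^ p`; this is its
tangent line at `|c| = a`. -/
lemma exists_cosh_tangent_rpow {p a : ℝ} (hp : 0 < p) (hp2 : p ≤ 2) (ha : 0 < a) (lam : ℝ) :
    ∃ κ : ℝ, 0 ≤ κ ∧ ∀ c : ℝ,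
      κ * (|c| ^ p - a ^ p) ≤ Real.cosh (lam * a * c) - Real.cosh (lam * a ^ 2) := by
  obtain ⟨κ, hκ, h⟩ := exists_cosh_tangent (lam * a ^ 2)
  have hap : 0 < a ^ p := Real.rpow_pos_of_pos ha p
  refine ⟨κ * (2 / p) / a ^ p, by positivity, fun c => ?_⟩
  have h1 := h (c / a)
  rw [show lam * a ^ 2 * (c / a) = lam * a * c by field_simp] at h1
  set τ := |c / a| ^ p with hτ
  have hτ0 : 0 ≤ τ := by positivity
  have h2 : τ ^ (2 / p) = (c / a) ^ 2 := by
    rw [hτ, ← Real.rpow_mul (abs_nonneg _), mul_div_cancel₀ _ hp.ne', Real.rpow_two, sq_abs]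
  have h3 : 1 + 2 / p * (τ - 1) ≤ (1 + (τ - 1)) ^ (2 / p) :=
    one_add_mul_self_le_rpow_one_add (by linarith) (by rw [le_div_iff₀ hp]; linarith)
  rw [add_sub_cancel, h2] at h3
  have h4 : τ = |c| ^ p / a ^ p := by
    rw [hτ, abs_div, abs_of_pos ha, Real.div_rpow (abs_nonneg _) ha.le]
  calc _ = κ * (2 / p * (τ - 1)) := by rw [h4]; field_simp
    _ ≤ κ * ((c / a) ^ 2 - 1) := by gcongr; linarith
    _ ≤ _ := h1

lemma nullVar_le_scoreMean {p a : ℝ} (hp : 0 < p) (hp2 : p ≤ 2) (ha : 0 < a) (lam : ℝ) {N : ℕ}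
    {c : Fin N → ℝ} (hc : N * a ^ p ≤ ∑ i, |c i| ^ p) :
    nullVar lam a N ≤ scoreMean lam a c := by
  obtain ⟨κ, hκ, h⟩ := exists_cosh_tangent_rpow hp hp2 ha lam
  have h1 := Finset.sum_le_sum fun i (_ : i ∈ Finset.univ) => h (c i)
  rw [← Finset.mul_sum, Finset.sum_sub_distrib, Finset.sum_sub_distrib] at h1
  simp only [Finset.sum_const, Finset.card_univ, Fintype.card_fin, nsmul_eq_mul] at h1
  have h2 : 0 ≤ κ * (∑ i, |c i| ^ p - N * a ^ p) := mul_nonneg hκ (by linarith)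
  have h3 : scoreMean lam a c = ∑ i, Real.cosh (lam * a * c i) - N := by
    simp [scoreMean]
  rw [h3, nullVar, mul_sub]
  linarith

/-! ### The score test -/

/-- The score test with critical value `u² / 2` has both error probabilities at most `Φ(-u/2)` up
to a small error: by asymptotic normality as long as the mean of the score stays bounded, and by
Chebyshev's inequality otherwise. -/
lemma exists_scoreTest_errors_le {M k δ : ℝ} (hM0 : 0 < M) (hk : 0 < k) (hδ : 0 < δ) :
    ∃ ξ₀ : ℝ, 0 < ξ₀ ∧ ξ₀ ≤ 1 ∧ ∀ (N : ℕ) (lam a ξ : ℝ) (c : Fin N → ℝ), 0 < lam → lam ≤ M →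
      0 < a → a ≤ ξ → ξ ≤ ξ₀ → (∀ i, |c i| ≤ ξ) → k ≤ √(nullVar lam a N) →
      nullVar lam a N ≤ scoreMean lam a c →
      (relLaw lam (fun _ : Fin N => 0)).real {o | nullVar lam a N / 2 < scoreSum lam a o} +
          (relLaw lam c).real {o | scoreSum lam a o ≤ nullVar lam a N / 2} ≤
        2 * stdNormalCDF (-√(nullVar lam a N) / 2) + δ := by
  obtain ⟨C, hC, hcheb⟩ := exists_scoreSum_chebyshev hM0
  set K := 16 * C / δ with hK
  have hK0 : 0 < K := by positivity
  have hKδ : K * δ = 16 * C := by rw [hK]; field_simp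
  obtain ⟨ξ₀, hξ₀, hξ₀1, hclt⟩ := exists_scoreSum_normal_approx (K := K) hM0 hk
    (by positivity : 0 < δ / 2)
  refine ⟨ξ₀, hξ₀, hξ₀1, fun N lam a ξ c hl hM ha haξ hξ hc hku hnm => ?_⟩
  have hξ1 : ξ ≤ 1 := hξ.trans hξ₀1
  have hξ0 : 0 < ξ := ha.trans_le haξ
  set u := √(nullVar lam a N) with hu
  have hu0 : 0 < u := hk.trans_le hku
  have hu2 : nullVar lam a N = u ^ 2 := (Real.sq_sqrt (nullVar_nonneg _ _ _)).symm
  set μ := scoreMean lam a c with hμ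
  rw [hu2] at hnm ⊢
  have hu2pos : 0 < u ^ 2 := by positivity
  have hμ0 : 0 < μ := hu2pos.trans_le hnm
  have h0 : ∀ i : Fin N, |(fun _ => (0 : ℝ)) i| ≤ ξ := fun i => by simpa using hξ0.le
  have hΦ := stdNormalCDF_nonneg (-u / 2)
  have type1 : (relLaw lam (fun _ : Fin N => 0)).real {o | u ^ 2 / 2 < scoreSum lam a o} ≤
      stdNormalCDF (-u / 2) + δ / 2 := by
    rcases le_or_gt K (u ^ 2) with h | h
    · have h1 := hcheb N lam a ξ _ hl hM ha haξ hξ1 h0 (u ^ 2 / 2) (by positivity)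
      rw [scoreMean_zero, hu2] at h1
      refine (measureReal_mono fun o ho => ?_).trans (h1.trans ?_)
      · simp only [Set.mem_ofPred_eq] at ho ⊢
        rw [sub_zero]
        exact ho.le.trans (le_abs_self _)
      · have : C * (u ^ 2 + 0) / (u ^ 2 / 2) ^ 2 ≤ δ / 2 := by
          rw [div_le_iff₀ (by positivity)]
          have : K * δ ≤ u ^ 2 * δ := by gcongr
          nlinarith
        linarith
    · have h1 := hclt N lam a ξ _ hl hM ha haξ hξ h0 hku (by rw [scoreMean_zero]; exact hK0.le)
        (u ^ 2 / 2) (by rw [abs_of_pos (by positivity)]; linarith)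
      rw [scoreMean_zero, ← hu, show (u ^ 2 / 2 - 0) / u = u / 2 by field_simp; ring] at h1
      have hset : {o : Fin N → ℕ | u ^ 2 / 2 < scoreSum lam a o} =
          {o | scoreSum lam a o ≤ u ^ 2 / 2}ᶜ := by ext o; simp
      rw [hset, probReal_compl_eq_one_sub .of_discrete, neg_div, stdNormalCDF_neg]
      linarith [(abs_le.1 h1).1]
  have type2 : (relLaw lam c).real {o | scoreSum lam a o ≤ u ^ 2 / 2} ≤
      stdNormalCDF (-u / 2) + δ / 2 := by
    rcases le_or_gt K μ with h | h
    · have h1 := hcheb N lam a ξ _ hl hM ha haξ hξ1 hc (μ / 2) (by positivity)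
      rw [← hμ, hu2] at h1
      refine (measureReal_mono fun o ho => ?_).trans (h1.trans ?_)
      · simp only [Set.mem_ofPred_eq] at ho ⊢
        rw [abs_sub_comm]
        exact le_trans (by linarith) (le_abs_self _)
      · have : C * (u ^ 2 + μ) / (μ / 2) ^ 2 ≤ δ / 2 := by
          rw [div_le_iff₀ (by positivity)]
          have h2 : K * δ ≤ μ * δ := by gcongr
          have h3 : C * (u ^ 2 + μ) ≤ C * (μ + μ) := by gcongr
          nlinarith
        linarith
    · have h1 := hclt N lam a ξ _ hl hM ha haξ hξ hc hku h.le
        (u ^ 2 / 2) (by rw [abs_of_pos (by positivity)]; linarith)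
      rw [← hμ, ← hu] at h1
      have h2 : stdNormalCDF ((u ^ 2 / 2 - μ) / u) ≤ stdNormalCDF (-u / 2) := by
        refine stdNormalCDF_mono ?_
        rw [div_le_iff₀ hu0]
        nlinarith
      linarith [(abs_le.1 h1).2]
  linarith

/-! ### From absolute to relative perturbations -/

lemma tsum_poisMass_mul {lam : ℝ} (hl : 0 ≤ lam) (f : ℕ → ℝ) :
    ∑' m, poisMass lam m * f m = ∫ m, f m ∂poissonMeasure (Real.toNNReal lam) := by
  rw [integral_poissonMeasure, Real.coe_toNNReal _ hl]
  rfl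

/-- The relative size `N (ε N^{-1/p})` of the perturbations of the two-point prior. -/
def relPert (p : ℝ) (N : ℕ) (ε : ℝ) : ℝ := N * (ε * (N : ℝ) ^ (-(1 / p)))

lemma relPert_pos {p ε : ℝ} {N : ℕ} (hN : 1 ≤ N) (hε : 0 < ε) : 0 < relPert p N ε := by
  have : (0 : ℝ) < N := by exact_mod_cast hN
  have := Real.rpow_pos_of_pos this (-(1 / p))
  unfold relPert; positivity

lemma relPert_le {p ε ξ : ℝ} {N : ℕ} (hN : 1 ≤ N)
    (h : ε ≤ ξ * (N : ℝ) ^ (-1 + 1 / p)) : relPert p N ε ≤ ξ := by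
  have hN0 : (0 : ℝ) < N := by exact_mod_cast hN
  have h1 := Real.rpow_pos_of_pos hN0 (-(1 / p))
  have e : (N : ℝ) ^ (-1 + 1 / p) * (N : ℝ) ^ (-(1 / p)) = (N : ℝ)⁻¹ := by
    rw [← Real.rpow_add hN0, add_neg_cancel_right, Real.rpow_neg_one]
  calc relPert p N ε ≤ N * (ξ * (N : ℝ) ^ (-1 + 1 / p) * (N : ℝ) ^ (-(1 / p))) := by
        unfold relPert; gcongr
    _ = ξ := by rw [mul_assoc, e]; field_simp

lemma relPert_rpow {p ε : ℝ} {N : ℕ} (hN : 1 ≤ N) (hp : 0 < p) (hε : 0 < ε) :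
    N * relPert p N ε ^ p = (N : ℝ) ^ p * ε ^ p := by
  have hN0 : (0 : ℝ) < N := by exact_mod_cast hN
  have h1 := Real.rpow_pos_of_pos hN0 (-(1 / p))
  have e : ((N : ℝ) ^ (-(1 / p))) ^ p = (N : ℝ)⁻¹ := by
    rw [← Real.rpow_mul hN0.le, neg_mul, one_div, inv_mul_cancel₀ hp.ne', Real.rpow_neg_one]
  unfold relPert
  rw [Real.mul_rpow hN0.le (by positivity), Real.mul_rpow hε.le h1.le, e]
  field_simp

lemma mul_relPert (p n ε : ℝ) {N : ℕ} (hN : 1 ≤ N) :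
    n * ε * (N : ℝ) ^ (-(1 / p)) = n / N * relPert p N ε := by
  have hN0 : (N : ℝ) ≠ 0 := by positivity
  unfold relPert; field_simp

lemma uVal_eq_sqrt_nullVar {p n ε : ℝ} {N : ℕ} (hN : 1 ≤ N) (hn : 0 < n) :
    uVal p N n ε = √(nullVar (n / N) (relPert p N ε) N) := by
  have hl : 0 < n / N := div_pos hn (by exact_mod_cast hN)
  unfold uVal nullVar
  rw [mul_relPert p n ε hN, tsum_poisMass_mul hl.le, integral_gFun_sq_null hl]

lemma abs_mul_sub_one {N : ℕ} (hN : 1 ≤ N) (q : ℝ) :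
    |N * q - 1| = N * |q - 1 / (N : ℝ)| := by
  have hN0 : (0 : ℝ) < N := by exact_mod_cast hN
  rw [← abs_of_pos hN0, ← abs_mul, abs_of_pos hN0]
  congr 1; field_simp

lemma altSet_rel {p ε ξ : ℝ} {N : ℕ} (hN : 1 ≤ N) (hp : 0 < p) (hε : 0 < ε) {Q : Fin N → ℝ}
    (hQ : Q ∈ altSet p N ε ξ) :
    (∀ i, |N * Q i - 1| ≤ ξ) ∧ N * relPert p N ε ^ p ≤ ∑ i, |N * Q i - 1| ^ p := by
  have hN0 : (0 : ℝ) < N := by exact_mod_cast hN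
  obtain ⟨-, h2, h3⟩ := hQ
  refine ⟨fun i => ?_, ?_⟩
  · rw [abs_mul_sub_one hN, mul_comm, ← le_div_iff₀ hN0]; exact h3 i
  · have e : ∀ i, |N * Q i - 1| ^ p = (N : ℝ) ^ p * |Q i - 1 / (N : ℝ)| ^ p := fun i => by
      rw [abs_mul_sub_one hN, Real.mul_rpow hN0.le (abs_nonneg _)]
    simp_rw [e]
    rw [← Finset.mul_sum, relPert_rpow hN hp hε]
    gcongr

/-- The rate vector with relative perturbations `± a`. -/
lemma signPert_mem_altSet {p ε ξ : ℝ} {N : ℕ} (hN : 1 ≤ N) (hp : 0 < p) (hε : 0 < ε)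
    (hξ : ξ ≤ 1) (h : ε ≤ ξ * (N : ℝ) ^ (-1 + 1 / p)) (s : Fin N → Bool) :
    (fun i => (1 + signPert (relPert p N ε) s i) / (N : ℝ)) ∈ altSet p N ε ξ := by
  have hN0 : (0 : ℝ) < N := by exact_mod_cast hN
  have ha := relPert_pos (p := p) hN hε
  have haξ := relPert_le hN h
  have e : ∀ i, |(1 + signPert (relPert p N ε) s i) / (N : ℝ) - 1 / (N : ℝ)| =
      relPert p N ε / N := fun i => by
    rw [← sub_div, add_sub_cancel_left, abs_div, abs_of_pos hN0, abs_signPert ha.le]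
  refine ⟨fun i => ?_, ?_, fun i => ?_⟩
  · have := neg_abs_le (signPert (relPert p N ε) s i)
    rw [abs_signPert ha.le] at this
    exact div_nonneg (by linarith) hN0.le
  · simp_rw [e]
    rw [Finset.sum_const, Finset.card_univ, Fintype.card_fin, nsmul_eq_mul,
      Real.div_rpow ha.le hN0.le, ← mul_div_assoc, relPert_rpow hN hp hε]
    have := Real.rpow_pos_of_pos hN0 p
    rw [mul_div_cancel_left₀ _ this.ne']
  · exact (e i).trans_le (by gcongr)

lemma testRisk_eq (n : ℝ) {N : ℕ} (hN : 1 ≤ N) (ψ : (Fin N → ℕ) → Bool) (Q : Fin N → ℝ) :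
    testRisk n ψ Q = (relLaw (n / N) (fun _ : Fin N => 0)).real {o | ψ o = true} +
      (relLaw (n / N) (fun i => N * Q i - 1)).real {o | ψ o = false} := by
  rw [testRisk, dataLaw_unifRate n hN, dataLaw_eq_relLaw n hN]

lemma testRisk_nonneg (n : ℝ) {N : ℕ} (ψ : (Fin N → ℕ) → Bool) (Q : Fin N → ℝ) :
    0 ≤ testRisk n ψ Q := add_nonneg measureReal_nonneg measureReal_nonneg

lemma testRisk_le_two (n : ℝ) {N : ℕ} (hN : 1 ≤ N) (ψ : (Fin N → ℕ) → Bool) (Q : Fin N → ℝ) :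
    testRisk n ψ Q ≤ 2 := by
  rw [testRisk_eq n hN]
  have h1 := measureReal_le_one (μ := relLaw (n / N) (fun _ : Fin N => 0)) (s := {o | ψ o = true})
  have h2 := measureReal_le_one (μ := relLaw (n / N) (fun i => N * Q i - 1))
    (s := {o | ψ o = false})
  linarith

lemma bddAbove_testRisk (n : ℝ) {N : ℕ} (hN : 1 ≤ N) (ψ : (Fin N → ℕ) → Bool)
    (V : Set (Fin N → ℝ)) : BddAbove (Set.range fun Q : V => testRisk n ψ (Q : Fin N → ℝ)) :=
  ⟨2, by rintro _ ⟨Q, rfl⟩; exact testRisk_le_two n hN ψ Q⟩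

lemma iSup_testRisk_nonneg (n : ℝ) {N : ℕ} (ψ : (Fin N → ℕ) → Bool) (V : Set (Fin N → ℝ)) :
    0 ≤ ⨆ Q : V, testRisk n ψ (Q : Fin N → ℝ) :=
  Real.iSup_nonneg fun Q => testRisk_nonneg n ψ Q

lemma minimaxRisk_le {n b : ℝ} {N : ℕ} {V : Set (Fin N → ℝ)} (hV : V.Nonempty)
    (ψ : (Fin N → ℕ) → Bool) (h : ∀ Q ∈ V, testRisk n ψ Q ≤ b) : minimaxRisk n V ≤ b := by
  have : Nonempty V := hV.to_subtype
  exact (ciInf_le ⟨0, by rintro _ ⟨φ, rfl⟩; exact iSup_testRisk_nonneg n φ V⟩ ψ).trans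
    (ciSup_le fun Q => h Q Q.2)

/-- A uniform lower bound on the average risk over the sign prior bounds the minimax risk. -/
lemma le_minimaxRisk {p n ε ξ b : ℝ} {N : ℕ} (hN : 1 ≤ N) (hp : 0 < p) (hε : 0 < ε)
    (hξ : ξ ≤ 1) (h : ε ≤ ξ * (N : ℝ) ^ (-1 + 1 / p))
    (hb : ∀ ψ : (Fin N → ℕ) → Bool, 2 ^ N * b ≤ ∑ s : Fin N → Bool,
      ((relLaw (n / N) (fun _ : Fin N => 0)).real {o | ψ o = true} +
        (relLaw (n / N) (signPert (relPert p N ε) s)).real {o | ψ o = false})) :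
    b ≤ minimaxRisk n (altSet p N ε ξ) := by
  have hN0 : (N : ℝ) ≠ 0 := by positivity
  refine le_ciInf fun ψ => ?_
  have h1 : ∀ s ∈ (Finset.univ : Finset (Fin N → Bool)),
      (relLaw (n / N) (fun _ : Fin N => 0)).real {o | ψ o = true} +
        (relLaw (n / N) (signPert (relPert p N ε) s)).real {o | ψ o = false} ≤
      ⨆ Q : altSet p N ε ξ, testRisk n ψ (Q : Fin N → ℝ) := by
    intro s _
    refine le_trans (le_of_eq ?_) (le_ciSup (bddAbove_testRisk n hN ψ _)
      ⟨_, signPert_mem_altSet hN hp hε hξ h s⟩)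
    rw [testRisk_eq n hN]
    have e : (fun i => (N : ℝ) * ((1 + signPert (relPert p N ε) s i) / N) - 1) =
        signPert (relPert p N ε) s := by
      funext i; field_simp; ring
    simp only [e]
  have h2 := (hb ψ).trans (Finset.sum_le_card_nsmul _ _ _ h1)
  rw [Finset.card_univ, Fintype.card_fun, Fintype.card_bool, Fintype.card_fin, nsmul_eq_mul] at h2
  push_cast at h2
  exact le_of_mul_le_mul_left h2 (by positivity)

/-! ### The asymptotic minimax risk -/

lemma exists_minimaxRisk_ge {M δ : ℝ} (hM0 : 0 < M) (hδ : 0 < δ) :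
    ∃ ξ₀ : ℝ, 0 < ξ₀ ∧ ∀ (p : ℝ) (N : ℕ) (n ε ξ : ℝ), 0 < p → 1 ≤ N → 0 < n → n / N ≤ M →
      ξ ≤ ξ₀ → 0 < ε → ε ≤ ξ * (N : ℝ) ^ (-1 + 1 / p) →
      2 * stdNormalCDF (-(uVal p N n ε) / 2) - δ ≤ minimaxRisk n (altSet p N ε ξ) := by
  -- for `u ≤ k` the chi-square bound applies, for `u ≥ K` the claimed bound is non-positive
  set k := √(Real.log (1 + δ ^ 2)) with hk
  have hk0 : 0 < k := Real.sqrt_pos.2 (Real.log_pos (by nlinarith [pow_pos hδ 2]))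
  have hk2 : k ^ 2 = Real.log (1 + δ ^ 2) :=
    Real.sq_sqrt (Real.log_nonneg (by nlinarith [pow_pos hδ 2]))
  obtain ⟨y, hy⟩ := ((tendsto_cdf_atBot (gaussianReal 0 1)).eventually
    (ge_mem_nhds (by positivity : (0 : ℝ) < δ / 2))).exists
  set K := max 1 (-(2 * y)) with hK
  have hK0 : 0 < K := by positivity
  obtain ⟨ξ₀, hξ₀, hξ₀1, hLR⟩ := exists_likelihoodTest_errors_ge hM0 hk0 hK0 hδ
  refine ⟨ξ₀, hξ₀, fun p N n ε ξ hp hN hn hM hξ hε h => ?_⟩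
  have hl : 0 < n / N := div_pos hn (by exact_mod_cast hN)
  have ha := relPert_pos (p := p) hN hε
  have haξ := relPert_le hN h
  have hξ1 := hξ.trans hξ₀1
  have hu := uVal_eq_sqrt_nullVar (p := p) (ε := ε) hN hn
  rw [hu]
  set a := relPert p N ε with hadef
  set u := √(nullVar (n / N) a N) with hudef
  have hu0 : 0 ≤ u := Real.sqrt_nonneg _
  have hu2 : u ^ 2 = nullVar (n / N) a N := Real.sq_sqrt (nullVar_nonneg _ _ _)
  have hhalf : stdNormalCDF (-u / 2) ≤ 1 / 2 := by
    rw [← stdNormalCDF_zero]; exact stdNormalCDF_mono (by linarith)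
  rcases le_or_gt u k with huk | huk
  · refine le_minimaxRisk hN hp hε hξ1 h fun ψ => ?_
    refine le_trans ?_ (sum_errors_ge_of_small hl ha (haξ.trans hξ1) ψ hδ)
    refine mul_le_mul_of_nonneg_left ?_ (by positivity)
    have h1 : Real.exp (N * (Real.cosh (n / N * a ^ 2) - 1)) ≤ 1 + δ ^ 2 := by
      have h2 : N * (Real.cosh (n / N * a ^ 2) - 1) ≤ Real.log (1 + δ ^ 2) := by
        rw [← hk2]
        exact hu2.symm.le.trans (pow_le_pow_left₀ hu0 huk 2)
      calc _ ≤ _ := Real.exp_le_exp.2 h2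
        _ = _ := Real.exp_log (by positivity)
    have h3 : (Real.exp (N * (Real.cosh (n / N * a ^ 2) - 1)) - 1) / δ ≤ δ := by
      rw [div_le_iff₀ hδ]; linarith [h1, sq δ]
    linarith
  rcases le_or_gt u K with huK | huK
  · refine le_minimaxRisk hN hp hε hξ1 h fun ψ => ?_
    set φ : (Fin N → ℕ) → Bool := fun o => decide (1 ≤ ∏ i, (1 + gFun (o i) (n / N) (n / N * a)))
      with hφ
    have hφ' : ∀ o, φ o = true ↔ 1 ≤ ∏ i, (1 + gFun (o i) (n / N) (n / N * a)) := fun o => by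
      simp [hφ]
    refine le_trans ?_ (sum_errors_likelihoodTest_le hl ha (haξ.trans hξ1) ψ φ hφ')
    have := Finset.card_nsmul_le_sum (Finset.univ : Finset (Fin N → Bool)) _ _
      fun s _ => hLR N (n / N) a ξ s hl hM ha haξ hξ huk.le huK φ hφ'
    rw [Finset.card_univ, Fintype.card_fun, Fintype.card_bool, Fintype.card_fin,
      nsmul_eq_mul] at this
    push_cast at this
    exact this
  · have h1 : stdNormalCDF (-u / 2) ≤ δ / 2 := by
      refine (stdNormalCDF_mono ?_).trans hy
      have := (le_max_right 1 (-(2 * y))).trans huK.le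
      linarith
    have h2 : 0 ≤ minimaxRisk n (altSet p N ε ξ) :=
      Real.iInf_nonneg fun ψ => iSup_testRisk_nonneg n ψ _
    linarith

lemma exists_minimaxRisk_le {M δ : ℝ} (hM0 : 0 < M) (hδ : 0 < δ) :
    ∃ ξ₀ : ℝ, 0 < ξ₀ ∧ ∀ (p : ℝ) (N : ℕ) (n ε ξ : ℝ), 0 < p → p ≤ 2 → 1 ≤ N → 0 < n →
      n / N ≤ M → ξ ≤ ξ₀ → 0 < ε → ε ≤ ξ * (N : ℝ) ^ (-1 + 1 / p) →
      minimaxRisk n (altSet p N ε ξ) ≤ 2 * stdNormalCDF (-(uVal p N n ε) / 2) + δ := by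
  obtain ⟨ξ₀, hξ₀, hξ₀1, hT⟩ := exists_scoreTest_errors_le hM0 hδ hδ
  refine ⟨ξ₀, hξ₀, fun p N n ε ξ hp hp2 hN hn hM hξ hε h => ?_⟩
  have hl : 0 < n / N := div_pos hn (by exact_mod_cast hN)
  have ha := relPert_pos (p := p) hN hε
  have haξ := relPert_le hN h
  have hξ1 := hξ.trans hξ₀1
  rw [uVal_eq_sqrt_nullVar (p := p) (ε := ε) hN hn]
  set a := relPert p N ε with hadef
  set u := √(nullVar (n / N) a N) with hudef
  have hu0 : 0 ≤ u := Real.sqrt_nonneg _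
  have hne : (altSet p N ε ξ).Nonempty :=
    ⟨_, signPert_mem_altSet hN hp hε hξ1 h fun _ => true⟩
  rcases le_or_gt δ u with hu | hu
  · refine minimaxRisk_le hne
      (fun o => decide (nullVar (n / N) a N / 2 < scoreSum (n / N) a o)) fun Q hQ => ?_
    obtain ⟨hQ1, hQ2⟩ := altSet_rel hN hp hε hQ
    have h1 := hT N (n / N) a ξ _ hl hM ha haξ hξ hQ1 hu
      (nullVar_le_scoreMean hp hp2 ha (n / N) hQ2)
    rw [testRisk_eq n hN]
    simpa only [decide_eq_true_eq, decide_eq_false_iff_not, not_lt] using h1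
  · -- the trivial test that always rejects has risk `1`
    refine minimaxRisk_le hne (fun _ => true) fun Q hQ => ?_
    rw [testRisk_eq n hN]
    have h1 := stdNormalCDF_sub_le (show -u / 2 ≤ 0 by linarith)
    rw [stdNormalCDF_zero] at h1
    simp
    linarith

/-! ### Linear statistics of the histogram -/

lemma poisMass_pos {lam : ℝ} (hl : 0 < lam) (m : ℕ) : 0 < poisMass lam m := by
  unfold poisMass; positivity

lemma hasSum_poisMass_mul {lam : ℝ} (hl : 0 ≤ lam) {f : ℕ → ℝ}
    (hf : Integrable f (poissonMeasure (Real.toNNReal lam))) :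
    HasSum (fun m => poisMass lam m * f m) (∫ m, f m ∂poissonMeasure (Real.toNNReal lam)) := by
  have := hasSum_integral_poissonMeasure hf
  simp only [Real.coe_toNNReal _ hl, smul_eq_mul] at this
  exact this

lemma IsWeight.exists_le_pow {w : ℕ → ℝ} (hw : IsWeight w) :
    ∃ A s : ℝ, 0 ≤ A ∧ 0 ≤ s ∧ ∀ m, |w m| ≤ A * s ^ m := by
  obtain ⟨⟨C, -, h⟩, -⟩ := hw
  refine ⟨Real.exp C, Real.exp C, (Real.exp_pos _).le, (Real.exp_pos _).le, fun m => ?_⟩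
  refine (h m).trans_eq ?_
  rw [← Real.exp_nat_mul, ← Real.exp_add]
  ring_nf

lemma IsWeight.integrable_sq {w : ℕ → ℝ} (hw : IsWeight w) (r : NNReal) :
    Integrable (fun m => w m ^ 2) (poissonMeasure r) := by
  obtain ⟨A, s, hA, hs, h⟩ := hw.exists_le_pow
  refine integrable_poisson_of_le_pow r (A := A ^ 2) (s := s ^ 2) fun m => ?_
  rw [abs_pow, ← pow_mul, mul_comm 2 m, pow_mul, ← mul_pow]
  exact pow_le_pow_left₀ (abs_nonneg _) (h m) 2

lemma IsWeight.integrable {w : ℕ → ℝ} (hw : IsWeight w) (r : NNReal) :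
    Integrable w (poissonMeasure r) := by
  obtain ⟨A, s, -, -, h⟩ := hw.exists_le_pow
  exact integrable_poisson_of_le_pow r h

lemma IsWeight.integrable_mul_gFun {w : ℕ → ℝ} (hw : IsWeight w) (r : NNReal) {lam a : ℝ}
    (hl : 0 < lam) (ha : 0 < a) (ha1 : a ≤ 1) :
    Integrable (fun m => w m * gFun m lam (lam * a)) (poissonMeasure r) := by
  obtain ⟨A, s, hA, hs, h⟩ := hw.exists_le_pow
  refine integrable_poisson_of_le_pow r (A := A * (Real.exp lam + 1)) (s := s * 2) fun m => ?_
  rw [abs_mul, mul_pow]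
  calc _ ≤ A * s ^ m * ((Real.exp lam + 1) * 2 ^ m) :=
        mul_le_mul (h m) (abs_gFun_le hl ha ha1 m) (abs_nonneg _) (by positivity)
    _ = _ := by ring

/-- The quadratic form `⟨w, Σ w⟩` is `N` times the variance of `w` under the null. -/
lemma tsum_histCov {n : ℝ} {N : ℕ} (hN : 1 ≤ N) (hn : 0 < n) {w : ℕ → ℝ} (hw : IsWeight w) :
    ∑' m, w m * ∑' k, histCov N n m k * w k =
      N * (∫ m, w m ^ 2 ∂poissonMeasure (Real.toNNReal (n / N)) -
        (∫ m, w m ∂poissonMeasure (Real.toNNReal (n / N))) ^ 2) := by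
  have hN0 : (0 : ℝ) < N := by exact_mod_cast hN
  have hl : 0 < n / N := div_pos hn hN0
  set e := ∫ m, w m ∂poissonMeasure (Real.toNNReal (n / N)) with he
  have h1 := hasSum_poisMass_mul hl.le (hw.integrable _)
  have h2 := hasSum_poisMass_mul hl.le (hw.integrable_sq _)
  have hinner : ∀ m, ∑' k, histCov N n m k * w k =
      N * poisMass (n / N) m * w m - N * poisMass (n / N) m * e := by
    intro m
    have hd : HasSum (fun k => (if m = k then (N : ℝ) * poisMass (n / N) m else 0) * w k)
        (N * poisMass (n / N) m * w m) := by
      have := hasSum_ite_eq m ((N : ℝ) * poisMass (n / N) m * w m)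
      refine this.congr_fun fun k => ?_
      by_cases h : m = k
      · subst h; simp
      · simp [h, Ne.symm h]
    have hp := h1.mul_left ((N : ℝ) * poisMass (n / N) m)
    rw [← (hd.sub hp).tsum_eq]
    refine tsum_congr fun k => ?_
    unfold histCov
    field_simp
  have hsum := ((h2.mul_left (N : ℝ)).sub (h1.mul_left ((N : ℝ) * e)))
  rw [show (N : ℝ) * (∫ m, w m ^ 2 ∂poissonMeasure (Real.toNNReal (n / N)) - e ^ 2) =
    N * ∫ m, w m ^ 2 ∂poissonMeasure (Real.toNNReal (n / N)) - N * e * e by ring, ← hsum.tsum_eq]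
  refine tsum_congr fun m => ?_
  rw [hinner]
  ring

/-! ### The two-point prior -/

lemma integral_twoPointPrior (p : ℝ) (N : ℕ) (ε : ℝ) (i : Fin N) (f : ℝ → ℝ) :
    ∫ t, f t ∂twoPointPrior p N ε i =
      (f (1 / (N : ℝ) + ε * (N : ℝ) ^ (-(1 / p))) +
        f (1 / (N : ℝ) - ε * (N : ℝ) ^ (-(1 / p)))) / 2 := by
  unfold twoPointPrior
  have hi : ∀ x : ℝ, Integrable f ((2⁻¹ : ℝ≥0∞) • Measure.dirac x) := fun x =>
    (integrable_dirac (by simp)).smul_measure (by simp)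
  rw [integral_add_measure (hi _) (hi _), integral_smul_measure, integral_smul_measure,
    integral_dirac, integral_dirac]
  simp
  ring

lemma twoPointPrior_mem_priorSet {p ε ξ : ℝ} {N : ℕ} (hp : 0 < p) (hN : 1 ≤ N) (hε : 0 < ε)
    (h : ε ≤ ξ * (N : ℝ) ^ (-1 + 1 / p)) : twoPointPrior p N ε ∈ priorSet p N ε ξ := by
  have hN0 : (0 : ℝ) < N := by exact_mod_cast hN
  have hd : 0 < (N : ℝ) ^ (-(1 / p)) := Real.rpow_pos_of_pos hN0 _
  have hhalf : (2⁻¹ : ℝ≥0∞) + 2⁻¹ = 1 := ENNReal.inv_two_add_inv_two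
  have hpert : ε * (N : ℝ) ^ (-(1 / p)) ≤ ξ / N := by
    rw [le_div_iff₀ hN0, mul_comm]
    exact relPert_le hN h
  have hpos : 0 < ε * (N : ℝ) ^ (-(1 / p)) := by positivity
  refine ⟨fun i => ⟨?_⟩, ?_, fun i => ?_⟩
  · simp [twoPointPrior, hhalf]
  · simp_rw [fun i => integral_twoPointPrior p N ε i]
    have e : (((ε * (N : ℝ) ^ (-(1 / p))) ^ p + (ε * (N : ℝ) ^ (-(1 / p))) ^ p) / 2) =
        ε ^ p * (N : ℝ)⁻¹ := by
      rw [add_self_div_two, Real.mul_rpow hε.le hd.le, ← Real.rpow_mul hN0.le, neg_mul, one_div,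
        inv_mul_cancel₀ hp.ne', Real.rpow_neg_one]
    have e1 : ∀ d : ℝ, |1 / (N : ℝ) + d - 1 / (N : ℝ)| = |d| := fun d => by ring_nf
    have e2 : ∀ d : ℝ, |1 / (N : ℝ) - d - 1 / (N : ℝ)| = |d| := fun d => by
      rw [← abs_neg d]; ring_nf
    rw [e1, e2, abs_of_pos hpos, e]
    simp
    field_simp
    exact le_rfl
  · have hm : MeasurableSet (Set.Icc ((1 - ξ) / (N : ℝ)) ((1 + ξ) / (N : ℝ))) := measurableSet_Icc
    have m1 : 1 / (N : ℝ) + ε * (N : ℝ) ^ (-(1 / p)) ∈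
        Set.Icc ((1 - ξ) / (N : ℝ)) ((1 + ξ) / (N : ℝ)) := by
      rw [sub_div, add_div]; constructor <;> linarith
    have m2 : 1 / (N : ℝ) - ε * (N : ℝ) ^ (-(1 / p)) ∈
        Set.Icc ((1 - ξ) / (N : ℝ)) ((1 + ξ) / (N : ℝ)) := by
      rw [sub_div, add_div]; constructor <;> linarith
    unfold twoPointPrior
    rw [Measure.add_apply, Measure.smul_apply, Measure.smul_apply, Measure.dirac_apply' _ hm,
      Measure.dirac_apply' _ hm, Set.indicator_of_mem m1, Set.indicator_of_mem m2]
    simp [hhalf]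

lemma meanShift_twoPointPrior {p n ε : ℝ} {N : ℕ} (hN : 1 ≤ N) (m : ℕ) :
    meanShift n (twoPointPrior p N ε) m =
      N * poisMass (n / N) m * gFun m (n / N) (n / N * relPert p N ε) := by
  unfold meanShift
  simp_rw [fun i => integral_twoPointPrior p N ε i]
  have e1 : n * (1 / (N : ℝ) + ε * (N : ℝ) ^ (-(1 / p)) - 1 / (N : ℝ)) =
      n / N * relPert p N ε := by rw [← mul_relPert p n ε hN]; ring
  have e2 : n * (1 / (N : ℝ) - ε * (N : ℝ) ^ (-(1 / p)) - 1 / (N : ℝ)) =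
      -(n / N * relPert p N ε) := by rw [← mul_relPert p n ε hN]; ring
  rw [e1, e2, gFun]
  simp
  ring

lemma optWeight_eq {p n ε : ℝ} {N : ℕ} (hN : 1 ≤ N) (hn : 0 < n) :
    optWeight p N n ε = fun m => gFun m (n / N) (n / N * relPert p N ε) := by
  have hN0 : (0 : ℝ) < N := by exact_mod_cast hN
  funext m
  have := poisMass_pos (div_pos hn hN0) m
  rw [optWeight, meanShift_twoPointPrior hN]
  field_simp

lemma nullVar_pos {lam a : ℝ} {N : ℕ} (hN : 1 ≤ N) (hl : 0 < lam) (ha : 0 < a) :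
    0 < nullVar lam a N := by
  have hN0 : (0 : ℝ) < N := by exact_mod_cast hN
  have h1 := half_sq_le_cosh_sub_one (lam * a ^ 2)
  have h2 : 0 < (lam * a ^ 2) ^ 2 / 2 := by positivity
  exact mul_pos hN0 (by linarith)

lemma isWeight_gFun {lam a : ℝ} (hl : 0 < lam) (ha : 0 < a) (ha1 : a ≤ 1) :
    IsWeight fun m => gFun m lam (lam * a) := by
  constructor
  · refine ⟨Real.log (Real.exp lam + 1) + 1, ?_, fun m => (abs_gFun_le hl ha ha1 m).trans ?_⟩
    · have := Real.log_nonneg (show 1 ≤ Real.exp lam + 1 by linarith [Real.exp_pos lam])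
      linarith
    · have h0 := Real.log_nonneg (show 1 ≤ Real.exp lam + 1 by linarith [Real.exp_pos lam])
      have h1 : (2 : ℝ) ^ m ≤ Real.exp m := by
        rw [← Real.exp_one_pow]
        exact pow_le_pow_left₀ (by norm_num) (by linarith [Real.add_one_le_exp 1]) m
      calc (Real.exp lam + 1) * 2 ^ m
          ≤ Real.exp (Real.log (Real.exp lam + 1)) * Real.exp m := by
            rw [Real.exp_log (by positivity)]; gcongr
        _ = Real.exp (Real.log (Real.exp lam + 1) + m) := (Real.exp_add _ _).symm
        _ ≤ _ := by
            refine Real.exp_le_exp.2 ?_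
            have : (0 : ℝ) ≤ m := Nat.cast_nonneg m
            nlinarith
  · rintro ⟨x, hx⟩
    have h1 := integral_gFun_null hl a
    have h2 := integral_gFun_sq_null hl a
    simp_rw [hx] at h1 h2
    simp at h1
    have h3 := nullVar_pos le_rfl hl ha
    simp [nullVar, ← h2, h1] at h3

lemma tsum_mul_meanShift_twoPointPrior {p n ε : ℝ} {N : ℕ} (hN : 1 ≤ N) (hn : 0 < n) (w : ℕ → ℝ) :
    ∑' m, w m * meanShift n (twoPointPrior p N ε) m =
      N * ∫ m, w m * gFun m (n / N) (n / N * relPert p N ε)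
        ∂poissonMeasure (Real.toNNReal (n / N)) := by
  have hl : 0 < n / N := div_pos hn (by exact_mod_cast hN)
  rw [← tsum_poisMass_mul hl.le, ← tsum_mul_left]
  refine tsum_congr fun m => ?_
  rw [meanShift_twoPointPrior hN]; ring

lemma tsum_histCov_gFun {n a : ℝ} {N : ℕ} (hN : 1 ≤ N) (hn : 0 < n) (ha : 0 < a) (ha1 : a ≤ 1) :
    ∑' m, gFun m (n / N) (n / N * a) * ∑' k, histCov N n m k * gFun k (n / N) (n / N * a) =
      nullVar (n / N) a N := by
  have hl : 0 < n / N := div_pos hn (by exact_mod_cast hN)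
  rw [tsum_histCov hN hn (isWeight_gFun hl ha ha1), integral_gFun_sq_null hl,
    integral_gFun_null hl, nullVar]
  ring

/-- Cauchy–Schwarz: `g` maximizes the standardized mean shift against the two-point prior. -/
lemma linShift_twoPointPrior_le {p n ε : ℝ} {N : ℕ} (hN : 1 ≤ N) (hn : 0 < n) (hε : 0 < ε)
    (ha1 : relPert p N ε ≤ 1) {w : ℕ → ℝ} (hw : IsWeight w) :
    linShift n w (twoPointPrior p N ε) ≤ √(nullVar (n / N) (relPert p N ε) N) := by
  have hN0 : (0 : ℝ) < N := by exact_mod_cast hN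
  have hl : 0 < n / N := div_pos hn hN0
  have ha := relPert_pos (p := p) hN hε
  have hnv := nullVar_pos hN hl ha
  unfold linShift
  rw [tsum_mul_meanShift_twoPointPrior hN hn, tsum_histCov hN hn hw]
  set a := relPert p N ε with hadef
  set P := poissonMeasure (Real.toNNReal (n / N)) with hP
  set I := ∫ m, w m * gFun m (n / N) (n / N * a) ∂P with hI
  set e := ∫ m, w m ∂P with he
  set q := ∫ m, w m ^ 2 ∂P with hq
  set ω := Real.cosh (n / N * a ^ 2) - 1 with hω
  have hωpos : 0 < ω := by
    have : 0 < N * ω := hnv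
    exact pos_of_mul_pos_right this hN0.le
  have ig : Integrable (fun m => gFun m (n / N) (n / N * a)) P := integrable_gFun _ hl ha ha1
  have ig2 : Integrable (fun m => gFun m (n / N) (n / N * a) ^ 2) P :=
    integrable_gFun_pow _ hl ha ha1 2
  have iw : Integrable w P := hw.integrable _
  have iw2 : Integrable (fun m => w m ^ 2) P := hw.integrable_sq _
  have iwg : Integrable (fun m => w m * gFun m (n / N) (n / N * a)) P :=
    hw.integrable_mul_gFun _ hl ha ha1
  have hCS : I ^ 2 ≤ ω * (q - e ^ 2) := by
    have hquad : 0 ≤ ∫ m, (w m - e - I / ω * gFun m (n / N) (n / N * a)) ^ 2 ∂P :=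
      integral_nonneg fun m => sq_nonneg _
    have hexp : ∀ m, (w m - e - I / ω * gFun m (n / N) (n / N * a)) ^ 2 =
        (w m ^ 2 - 2 * e * w m) + (e ^ 2 + ((I / ω) ^ 2 * gFun m (n / N) (n / N * a) ^ 2 +
          (2 * e * (I / ω) * gFun m (n / N) (n / N * a) -
            2 * (I / ω) * (w m * gFun m (n / N) (n / N * a))))) := fun m => by ring
    have j1 : Integrable (fun m => w m ^ 2 - 2 * e * w m) P := iw2.sub (iw.const_mul _)
    have j2 : Integrable (fun m => 2 * e * (I / ω) * gFun m (n / N) (n / N * a) -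
        2 * (I / ω) * (w m * gFun m (n / N) (n / N * a))) P :=
      (ig.const_mul _).sub (iwg.const_mul _)
    have j3 : Integrable (fun m => (I / ω) ^ 2 * gFun m (n / N) (n / N * a) ^ 2 +
          (2 * e * (I / ω) * gFun m (n / N) (n / N * a) -
            2 * (I / ω) * (w m * gFun m (n / N) (n / N * a)))) P := (ig2.const_mul _).add j2
    have j4 : Integrable (fun m => e ^ 2 + ((I / ω) ^ 2 * gFun m (n / N) (n / N * a) ^ 2 +
          (2 * e * (I / ω) * gFun m (n / N) (n / N * a) -
            2 * (I / ω) * (w m * gFun m (n / N) (n / N * a))))) P := (integrable_const _).add j3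
    simp_rw [hexp] at hquad
    rw [integral_add j1 j4, integral_add (integrable_const _) j3,
      integral_add (ig2.const_mul _) j2, integral_sub iw2 (iw.const_mul _),
      integral_sub (ig.const_mul _) (iwg.const_mul _), integral_const_mul, integral_const_mul,
      integral_const_mul, integral_const_mul, ← hI, ← he, ← hq, hP, integral_gFun_null hl,
      integral_gFun_sq_null hl, ← hω] at hquad
    simp only [integral_const, probReal_univ, smul_eq_mul] at hquad
    have h3 : q - e ^ 2 - I ^ 2 / ω ≥ 0 := by
      refine hquad.trans_eq ?_
      field_simp
      ring
    have h4 := mul_nonneg hωpos.le h3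
    have h5 : ω * (q - e ^ 2 - I ^ 2 / ω) = ω * (q - e ^ 2) - I ^ 2 := by field_simp
    linarith
  refine div_le_of_le_mul₀ (Real.sqrt_nonneg _) (Real.sqrt_nonneg _) ?_
  rw [← Real.sqrt_mul hnv.le]
  refine Real.le_sqrt_of_sq_le ?_
  rw [nullVar, ← hω]
  nlinarith [mul_le_mul_of_nonneg_left hCS (sq_nonneg (N : ℝ))]

/-! ### The least favorable prior -/

/-- The cross moment of the score `g` and the likelihood ratio at the perturbation `c`. -/
lemma hasSum_gFun_mul_hFun {lam a c : ℝ} (hl : 0 < lam) (ha : 0 < a) (ha1 : a ≤ 1)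
    (hc : -1 ≤ c) :
    HasSum (fun m => poisMass lam m * gFun m lam (lam * a) * hFun m lam (lam * c))
      (Real.cosh (lam * a * c) - 1) := by
  have h1 := hasSum_poisMass_mul (mul_nonneg hl.le (by linarith : 0 ≤ 1 + c))
    (integrable_gFun _ hl ha ha1)
  have h0 := hasSum_poisMass_mul hl.le (integrable_gFun _ hl ha ha1)
  rw [integral_gFun hl a hc] at h1
  rw [integral_gFun_null hl] at h0
  have := h1.sub h0
  rw [sub_zero] at this
  refine this.congr_fun fun m => ?_
  rw [← poisMass_mul_one_add_hFun hl.ne']; ring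

lemma nullVar_le_tsum_gFun_mul_meanShift {p n ε ξ : ℝ} {N : ℕ} (hp : 0 < p) (hp2 : p ≤ 2)
    (hN : 1 ≤ N) (hn : 0 < n) (hξ : ξ ≤ 1) (hε : 0 < ε) (ha1 : relPert p N ε ≤ 1)
    {π : Fin N → Measure ℝ} (hπ : π ∈ priorSet p N ε ξ) :
    nullVar (n / N) (relPert p N ε) N ≤
      ∑' m, gFun m (n / N) (n / N * relPert p N ε) * meanShift n π m := by
  obtain ⟨hprob, hsum, hsupp⟩ := hπ
  have hN0 : (0 : ℝ) < N := by exact_mod_cast hN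
  have hl : 0 < n / N := div_pos hn hN0
  have ha := relPert_pos (p := p) hN hε
  have hnorm := relPert_rpow hN hp hε
  set lam := n / N with hlam
  set a := relPert p N ε with hadef
  have hae : ∀ i, ∀ᵐ t : ℝ ∂π i, |(N : ℝ) * t - 1| ≤ 1 := by
    intro i
    have h1 : ∀ᵐ t ∂π i, t ∈ Set.Icc ((1 - ξ) / (N : ℝ)) ((1 + ξ) / (N : ℝ)) :=
      (mem_ae_iff_prob_eq_one measurableSet_Icc).2 (hsupp i)
    filter_upwards [h1] with t ht
    have h2 := (div_le_iff₀ hN0).1 ht.1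
    have h3 := (le_div_iff₀ hN0).1 ht.2
    rw [abs_le]; constructor <;> nlinarith
  have hx : ∀ t : ℝ, n * (t - 1 / (N : ℝ)) = lam * (N * t - 1) := fun t => by
    rw [hlam]; field_simp
  -- exchange of the sum over `m` and the integral over the prior, by domination
  have hi : ∀ i, HasSum (fun m => ∫ t, poisMass lam m * gFun m lam (lam * a) *
      hFun m lam (lam * (N * t - 1)) ∂π i) (∫ t, (Real.cosh (lam * a * (N * t - 1)) - 1) ∂π i) := by
    intro i
    have hbs : Summable fun m => poisMass lam m *
        ((Real.exp lam + 1) * 2 ^ m * ((Real.exp lam + 1) * 2 ^ m)) := by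
      refine (hasSum_poisMass_mul hl.le (integrable_poisson_of_le_pow _
        (A := (Real.exp lam + 1) ^ 2) (s := 4) fun m => ?_)).summable
      rw [abs_of_nonneg (by positivity), show (4 : ℝ) = 2 * 2 by norm_num, mul_pow]
      exact le_of_eq (by ring)
    refine hasSum_integral_of_dominated_convergence
      (fun m _ => poisMass lam m * ((Real.exp lam + 1) * 2 ^ m * ((Real.exp lam + 1) * 2 ^ m)))
      (fun m => ?_) (fun m => ?_) (Filter.Eventually.of_forall fun _ => hbs)
      (integrable_const _) ?_
    · refine Measurable.aestronglyMeasurable ?_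
      unfold hFun
      fun_prop
    · filter_upwards [hae i] with t ht
      obtain ⟨h1, h2⟩ := abs_le.1 ht
      have hP := (poisMass_pos hl m).le
      rw [Real.norm_eq_abs, abs_mul, abs_mul, abs_of_nonneg hP, mul_assoc]
      have hh : |hFun m lam (lam * (N * t - 1))| ≤ (Real.exp lam + 1) * 2 ^ m := by
        rw [hFun_mul hl.ne']
        have e1 : Real.exp (-(lam * (N * t - 1))) ≤ Real.exp lam :=
          Real.exp_le_exp.2 (by nlinarith)
        have e2 : (1 + (N * t - 1)) ^ m ≤ 2 ^ m :=
          pow_le_pow_left₀ (by linarith) (by linarith) m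
        have e3 : 0 ≤ (1 + (N * t - 1)) ^ m := pow_nonneg (by linarith) m
        have e4 := mul_le_mul e1 e2 e3 (Real.exp_pos _).le
        have e5 : 0 ≤ Real.exp (-(lam * (N * t - 1))) * (1 + (N * t - 1)) ^ m :=
          mul_nonneg (Real.exp_pos _).le e3
        have e6 : (1 : ℝ) ≤ 2 ^ m := one_le_pow₀ (by norm_num)
        have e7 : 0 < Real.exp lam * 2 ^ m := by positivity
        rw [abs_le]; constructor <;> linarith
      have hg := abs_gFun_le hl ha ha1 m
      gcongr
    · filter_upwards [hae i] with t ht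
      exact hasSum_gFun_mul_hFun hl ha ha1 (abs_le.1 ht).1
  have htot := hasSum_sum fun i (_ : i ∈ (Finset.univ : Finset (Fin N))) => hi i
  have heq : ∑' m, gFun m lam (lam * a) * meanShift n π m =
      ∑ i, ∫ t, (Real.cosh (lam * a * (N * t - 1)) - 1) ∂π i := by
    rw [← htot.tsum_eq]
    refine tsum_congr fun m => ?_
    unfold meanShift
    simp_rw [hx, integral_const_mul, ← hlam]
    rw [← Finset.mul_sum]; ring
  rw [heq]
  obtain ⟨κ, hκ, htan⟩ := exists_cosh_tangent_rpow hp hp2 ha lam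
  have hpint : ∀ i, Integrable (fun t => |t - 1 / (N : ℝ)| ^ p) (π i) := by
    intro i
    refine (integrable_const ((1 / (N : ℝ)) ^ p)).mono'
      (Measurable.aestronglyMeasurable (by fun_prop)) ?_
    filter_upwards [hae i] with t ht
    rw [abs_mul_sub_one hN] at ht
    rw [Real.norm_of_nonneg (by positivity)]
    refine Real.rpow_le_rpow (abs_nonneg _) ?_ hp.le
    rw [le_div_iff₀ hN0]; linarith
  have hcint : ∀ i, Integrable (fun t => Real.cosh (lam * a * (N * t - 1)) - 1) (π i) := by
    intro i
    refine (integrable_const (Real.cosh (lam * a) - 1)).mono'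
      (Measurable.aestronglyMeasurable (by fun_prop)) ?_
    filter_upwards [hae i] with t ht
    rw [Real.norm_of_nonneg (cosh_sub_one_nonneg _)]
    have : Real.cosh (lam * a * (N * t - 1)) ≤ Real.cosh (lam * a) := by
      rw [Real.cosh_le_cosh, abs_mul]
      exact mul_le_of_le_one_right (abs_nonneg _) ht
    linarith
  have hpt : ∀ i, κ * ((N : ℝ) ^ p * ∫ t, |t - 1 / (N : ℝ)| ^ p ∂π i - a ^ p) +
      (Real.cosh (lam * a ^ 2) - 1) ≤ ∫ t, (Real.cosh (lam * a * (N * t - 1)) - 1) ∂π i := by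
    intro i
    have j1 : Integrable (fun t => (N : ℝ) ^ p * |t - 1 / (N : ℝ)| ^ p - a ^ p) (π i) :=
      ((hpint i).const_mul _).sub (integrable_const _)
    have j2 : Integrable (fun t => κ * ((N : ℝ) ^ p * |t - 1 / (N : ℝ)| ^ p - a ^ p) +
        (Real.cosh (lam * a ^ 2) - 1)) (π i) := (j1.const_mul κ).add (integrable_const _)
    refine le_trans (le_of_eq ?_) (integral_mono j2 (hcint i) fun t => ?_)
    · rw [integral_add (j1.const_mul κ) (integrable_const _), integral_const_mul,
        integral_sub ((hpint i).const_mul _) (integrable_const _), integral_const_mul]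
      simp
    · have := htan (N * t - 1)
      rw [abs_mul_sub_one hN, Real.mul_rpow hN0.le (abs_nonneg _)] at this
      simp only
      linarith
  refine le_trans ?_ (Finset.sum_le_sum fun i _ => hpt i)
  rw [Finset.sum_add_distrib, ← Finset.mul_sum, Finset.sum_sub_distrib, ← Finset.mul_sum]
  simp only [Finset.sum_const, Finset.card_univ, Fintype.card_fin, nsmul_eq_mul]
  rw [hnorm, ← mul_sub, nullVar]
  have h1 : 0 ≤ κ * ((N : ℝ) ^ p * (∑ i, ∫ t, |t - 1 / (N : ℝ)| ^ p ∂π i - ε ^ p)) := by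
    have : 0 ≤ ∑ i, ∫ t, |t - 1 / (N : ℝ)| ^ p ∂π i - ε ^ p := by linarith
    positivity
  linarith

end PoissonUniformity

end

theorem theorem1 (M : ℝ) :
    -- the asymptotic minimax risk; the error depends on `M` only
    (∀ δ : ℝ, 0 < δ → ∃ (N₀ : ℕ) (n₀ ξ₀ : ℝ), 0 < ξ₀ ∧
      ∀ (p : ℝ) (N : ℕ) (n ε ξ : ℝ), 0 < p → p ≤ 2 →
        N₀ ≤ N → n₀ ≤ n → 1 ≤ N → 0 < n → n / N ≤ M → ξ ≤ ξ₀ →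
        0 < ε → ε ≤ ξ * (N : ℝ) ^ (-1 + 1 / p) →
        2 * PoissonUniformity.stdNormalCDF (-(PoissonUniformity.uVal p N n ε) / 2) ≤
            PoissonUniformity.minimaxRisk n (PoissonUniformity.altSet p N ε ξ) + δ ∧
          PoissonUniformity.minimaxRisk n (PoissonUniformity.altSet p N ε ξ) ≤
            2 * PoissonUniformity.stdNormalCDF (-(PoissonUniformity.uVal p N n ε) / 2) + δ) ∧
    -- the two-point prior is least favorable for linear tests of the histogram
    (∀ (p : ℝ) (N : ℕ) (n ε ξ : ℝ), 0 < p → p ≤ 2 → 1 ≤ N → 0 < n → ξ ≤ 1 →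
        0 < ε → ε ≤ ξ * (N : ℝ) ^ (-1 + 1 / p) →
        PoissonUniformity.twoPointPrior p N ε ∈ PoissonUniformity.priorSet p N ε ξ ∧
        PoissonUniformity.IsWeight (PoissonUniformity.optWeight p N n ε) ∧
        PoissonUniformity.linShift n (PoissonUniformity.optWeight p N n ε)
            (PoissonUniformity.twoPointPrior p N ε) = PoissonUniformity.uVal p N n ε ∧
        (∀ (z : ℝ) (w : ℕ → ℝ), PoissonUniformity.IsWeight w →
          PoissonUniformity.linPower n w z (PoissonUniformity.twoPointPrior p N ε) ≤
            PoissonUniformity.linPower n (PoissonUniformity.optWeight p N n ε) z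
              (PoissonUniformity.twoPointPrior p N ε)) ∧
        (∀ z : ℝ, ∀ π ∈ PoissonUniformity.priorSet p N ε ξ,
          PoissonUniformity.linPower n (PoissonUniformity.optWeight p N n ε) z
              (PoissonUniformity.twoPointPrior p N ε) ≤
            PoissonUniformity.linPower n (PoissonUniformity.optWeight p N n ε) z π)) := by
  refine ⟨fun δ hδ => ?_, fun p N n ε ξ hp hp2 hN hn hξ hε h => ?_⟩
  · -- no parameters satisfy `n / N ≤ M` when `M ≤ 0`
    rcases le_or_gt M 0 with hM | hM
    · refine ⟨0, 0, 1, one_pos, fun p N n ε ξ _ _ _ _ hN hn hnM => ?_⟩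
      have : 0 < n / N := div_pos hn (by exact_mod_cast hN)
      linarith
    · obtain ⟨ξ₁, hξ₁, h1⟩ := PoissonUniformity.exists_minimaxRisk_ge hM hδ
      obtain ⟨ξ₂, hξ₂, h2⟩ := PoissonUniformity.exists_minimaxRisk_le hM hδ
      -- the bounds hold for all `N` and `n`: only `ξ` needs to be small
      refine ⟨0, 0, min ξ₁ ξ₂, lt_min hξ₁ hξ₂, fun p N n ε ξ hp hp2 _ _ hN hn hnM hξ hε h => ?_⟩
      have b1 := h1 p N n ε ξ hp hN hn hnM (hξ.trans (min_le_left _ _)) hε h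
      exact ⟨by linarith, h2 p N n ε ξ hp hp2 hN hn hnM (hξ.trans (min_le_right _ _)) hε h⟩
  · have hl : 0 < n / N := div_pos hn (by exact_mod_cast hN)
    have ha := PoissonUniformity.relPert_pos (p := p) hN hε
    have ha1 := (PoissonUniformity.relPert_le hN h).trans hξ
    have hu := PoissonUniformity.uVal_eq_sqrt_nullVar (p := p) (ε := ε) hN hn
    have hnv := PoissonUniformity.nullVar_pos hN hl ha
    have hopt : PoissonUniformity.linShift n (PoissonUniformity.optWeight p N n ε)
        (PoissonUniformity.twoPointPrior p N ε) = PoissonUniformity.uVal p N n ε := by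
      rw [hu, PoissonUniformity.linShift, PoissonUniformity.tsum_mul_meanShift_twoPointPrior hN hn,
        PoissonUniformity.optWeight_eq hN hn, PoissonUniformity.tsum_histCov_gFun hN hn ha ha1]
      simp_rw [← sq]
      rw [PoissonUniformity.integral_gFun_sq_null hl]
      exact Real.div_sqrt
    refine ⟨PoissonUniformity.twoPointPrior_mem_priorSet hp hN hε h, ?_, hopt,
      fun z w hw => ?_, fun z π hπ => ?_⟩
    · rw [PoissonUniformity.optWeight_eq hN hn]
      exact PoissonUniformity.isWeight_gFun hl ha ha1
    · refine PoissonUniformity.stdNormalCDF_mono (sub_le_sub_right ?_ z)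
      rw [hopt, hu]
      exact PoissonUniformity.linShift_twoPointPrior_le hN hn hε ha1 hw
    · refine PoissonUniformity.stdNormalCDF_mono (sub_le_sub_right ?_ z)
      rw [hopt, hu, PoissonUniformity.linShift, PoissonUniformity.optWeight_eq hN hn,
        PoissonUniformity.tsum_histCov_gFun hN hn ha ha1, le_div_iff₀ (Real.sqrt_pos.2 hnv),
        Real.mul_self_sqrt hnv.le]
      exact PoissonUniformity.nullVar_le_tsum_gFun_mul_meanShift hp hp2 hN hn hξ hε ha1 hπ
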